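/- **Setting.** Let $\mathbb T^3=[0,L]^3$ be the torus of size $L>0$, let $\nu>0$, $T>0$, and write $\lambda_q=2^q/L$ ($q\in\mathbb Z$), $\kappa_0=2\pi/L$, and $\langle g\rangle(t)=\frac1T\int_t^{t+T}g(\tau)\,d\tau$. *Littlewood–Paley decomposition.* Fix a nonnegative radial $\chi\in C_c^\infty(\mathbb R^3)$ with $\chi(\xi)=1$ for $|\xi|\le 3/4$ and $\chi(\xi)=0$ for $|\xi|\ge1$. Put $\varphi(\xi)=\chi(\xi/2)-\chi(\xi)$, $\varphi_q(\xi)=\varphi(2^{-q}\xi)$ for $q\ge0$ and $\varphi_{-1}=\chi$. For a periodic distribution $v$ with Fourier coefficients $\hat v(k)$ let $v_q(x)=\sum_{k\in\mathbb Z^3}\varphi_q(k)\hat v(k)e^{i\frac{2\pi}{L}k\cdot x}$, $v_{\le q}=\sum_{p=-1}^q v_p$ and $\|v\|_{H^s}^2=\sum_{q\ge-1}\lambda_q^{2s}\|v_q\|_{2}^2$. Let $C_B>0$ be any constant in Bernstein's inequality $\lambda_q^{-1}\|v_q\|_\infty^2\le C_B\lambda_q^2\|v_q\|_2^2$ ($q\ge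 0$, for mean-zero $v\in L^2(\mathbb T^3;\mathbb R^3)$ and all $L$). *Equation.* Let $f$ be a real mean-zero force, translationally bounded in $L^2_{loc}(\mathbb R;H^{-1})$: $$\|f\|_{L^2_b(T)}^2:=\sup_{t\in\mathbb R}\frac1T\int_t^{t+T}\|f(\tau)\|_{H^{-1}}^2\,d\tau<\infty .$$ A *Leray–Hopf solution* on $[0,\infty)$ of $$u_t+(u\cdot\nabla)u-\nu\Delta u+\nabla p=f,\qquad \nabla\cdot u=0,$$ is a mean-zero divergence-free $u\in C([0,\infty);L^2_{\mathrm w}(\mathbb T^3))\cap L^2_{loc}(0,\infty;H^1)$ that solves the equation in the sense of distributions and satisfies $$\tfrac12\|u(t)\|_2^2\le\tfrac12\|u(t_0)\|_2^2-\nu\int_{t_0}^t\|\nabla u\|_2^2\,d\tau+\int_{t_0}^t(f,u)\,d\tau$$ for almost all $t_0>0$ and all $t>t_0$. A *complete* Leray–Hopf solution is a function $u$ on $\mathbb R$ such that for every $s\in\mathbb R$ the shift $u(\cdot-s)|_{[0,\infty)}$ is a Leray–Hopf solution with force $f(\cdot-s)$. *Determining wavenumber.* For $\delta>0$ and $c_0>0$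 call $q\in\mathbb N=\{0,1,2,\dots\}$ admissible for $u(t)$ if $$(L\lambda_{p-q})^{\frac{\delta-1}2}\lambda_q^{-1}\|u_p(t)\|_{\infty}<c_0\nu\quad\text{for all }p>q,\qquad \lambda_q^{-2}\|\nabla u_{\le q}(t)\|_{\infty}<c_0\nu,$$ and let $\Lambda_u(t)=\min\{\lambda_q: q\text{ admissible for }u(t)\}$. *Intermittency dimension and Kolmogorov's wavenumber.* Let $$d=d(u,t)=\sup\Big\{s\in\mathbb R:\Big\langle\sum_{q\ge -1}\lambda_q^{-1+s}\|u_q\|_\infty^2\Big\rangle\le C_B^{3-s}\lambda_0^s\Big\langle\sum_{q\ge -1}\lambda_q^2\|u_q\|_2^2\Big\rangle\Big\}$$ if $u\not\equiv0$ on $[t,t+T]$, and $d=3$ otherwise. Let $\varepsilon=\nu\lambda_0^d\langle\|\nabla u\|_2^2\rangle$ and $\kappa_{\mathrm d}=(\varepsilon/\nu^3)^{1/(d+1)}$. *Grashof number.* $$G=\frac{T^{1/2}\kappa_0^{1/2}\|f\|_{L^2_b(T)}}{\nu^{3/2}(1-e^{-\nu\kappa_0^2T})^{1/2}} .$$ **Theorem.**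 For every $\chi$ as above, every $\delta\in(0,3]$ and every $c_0>0$ there is a constant $\widetilde C>0$, depending only on $\chi,\delta,c_0$, with the following property. For all $L,\nu,T>0$, all forces $f$ as above, every complete Leray–Hopf solution $u$ that is bounded in $L^2$, and every $t\in\mathbb R$ with $d(u,t)=3$: the wavenumber $\Lambda_u(\tau)$ is defined (some $q$ is admissible) for almost every $\tau\in[t,t+T]$; the function $(\Lambda_u-\lambda_0)/(\log(\Lambda_u/\lambda_0))^{1/4}$, taken to be $0$ where $\Lambda_u=\lambda_0$, is integrable on $[t,t+T]$; and $$\left\langle\frac{\Lambda_u-\lambda_0}{(\log(\Lambda_u/\lambda_0))^{1/4}}\right\rangle\le\widetilde C\,\kappa_{\mathrm d}\le\widetilde C\,\kappa_0\,G^{1/2}\left(\frac1{\nu T\kappa_0^2}+1\right)^{1/4}.$$ If $f$ is independent of time, the last inequality also holds with $G=\|f\|_{H^{-1}}/(\nu^2\kappa_0^{1/2})$. -/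

import Mathlib

open MeasureTheory Set
open scoped ENNReal ContDiff

noncomputable section

namespace NSE

/-- Physical space `ℝ³` with the Euclidean norm. -/
abbrev E3 : Type := EuclideanSpace ℝ (Fin 3)

/-- Complex vectors `ℂ³` with the Hermitian norm. -/
abbrev C3 : Type := EuclideanSpace ℂ (Fin 3)

/-- The lattice `ℤ³` of frequencies. -/
abbrev Freq : Type := Fin 3 → ℤ

/-- The period cell `[0,L]³` of the torus of size `L`. -/
def cube (L : ℝ) : Set E3 := {x | ∀ i, x i ∈ Icc (0 : ℝ) L}

/-- `L²(𝕋³; ℝ³)`, where the torus `𝕋³` is `[0,L]³` with opposite faces identified. -/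
abbrev L2 (L : ℝ) : Type := Lp E3 2 ((volume : Measure E3).restrict (cube L))

/-- `L`-periodicity in each of the three coordinate directions. -/
def Periodic {F : Type*} (L : ℝ) (g : E3 → F) : Prop :=
  ∀ (x : E3) (j : Fin 3), g (x + EuclideanSpace.single j L) = g x

/-! ### Fourier series -/

/-- The dot product `k · x`. -/
def dot (k : Freq) (x : E3) : ℝ := ∑ j, (k j : ℝ) * x j

/-- The character `e^{i (2π/L) k·x}`. -/
def character (L : ℝ) (k : Freq) (x : E3) : ℂ :=
  Complex.exp (Complex.I * ((2 * Real.pi / L * dot k x : ℝ) : ℂ))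

/-- The frequency `k ∈ ℤ³` as a point of `ℝ³`. -/
def freqVec (k : Freq) : E3 := WithLp.toLp 2 (fun j => (k j : ℝ))

/-- The Fourier coefficients `v̂(k) = L⁻³ ∫_{[0,L]³} v(x) e^{-i(2π/L)k·x} dx`. -/
def coeff (L : ℝ) (v : E3 → E3) (k : Freq) : C3 :=
  WithLp.toLp 2 (fun i =>
    ((L ^ 3 : ℝ) : ℂ)⁻¹ * ∫ x in cube L, character L (-k) x * ((v x i : ℝ) : ℂ))

/-- The duality pairing `(f, v) = L³ ∑ₖ f̂(k) · conj v̂(k)` of fields given by their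
Fourier coefficients (the `L²` inner product when both are square integrable). -/
def pairing (L : ℝ) (fhat vhat : Freq → C3) : ℝ :=
  L ^ 3 * ∑' k, (inner ℂ (vhat k) (fhat k)).re

/-- `‖∇v‖₂² = L³ ∑ₖ |2πk/L|² |v̂(k)|²`, infinite if `v` is not in `H¹`. -/
def gradSq (L : ℝ) (v : E3 → E3) : ℝ≥0∞ :=
  ENNReal.ofReal (L ^ 3) *
    ∑' k : Freq, ENNReal.ofReal ((2 * Real.pi / L * ‖freqVec k‖) ^ 2) * ‖coeff L v k‖ₑ ^ 2

/-! ### Littlewood–Paley decomposition -/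

/-- The radial cut-off functions from which a Littlewood–Paley decomposition is built. -/
structure IsCutoff (χ : E3 → ℝ) : Prop where
  smooth : ContDiff ℝ ∞ χ
  nonneg : ∀ ξ, 0 ≤ χ ξ
  radial : ∀ ξ η, ‖ξ‖ = ‖η‖ → χ ξ = χ η
  eq_one : ∀ ξ, ‖ξ‖ ≤ 3 / 4 → χ ξ = 1
  eq_zero : ∀ ξ, 1 ≤ ‖ξ‖ → χ ξ = 0

/-- The dyadic wavenumber `λ_q = 2^q / L`, for integers `q`. -/
def lam (L : ℝ) (q : ℤ) : ℝ := (2 : ℝ) ^ q / L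

/-- The symbol `φ_q`: with `φ(ξ) = χ(ξ/2) - χ(ξ)`, it is `φ(2^{-q} ξ)` for `q ≥ 0` and `χ` for
`q = -1` (only `q ≥ -1` is ever used). -/
def symbol (χ : E3 → ℝ) (q : ℤ) (ξ : E3) : ℝ :=
  if 0 ≤ q then χ ((2 : ℝ)⁻¹ • ((2 : ℝ) ^ (-q)) • ξ) - χ (((2 : ℝ) ^ (-q)) • ξ) else χ ξ

/-- The Littlewood–Paley projection `x ↦ ∑ₖ φ_q(k) ĉ(k) e^{i(2π/L)k·x}` of the periodic
distribution with Fourier coefficients `c` (a finite sum). -/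
def block (χ : E3 → ℝ) (L : ℝ) (q : ℤ) (c : Freq → C3) (x : E3) : C3 :=
  ∑' k : Freq, ((symbol χ q (freqVec k) : ℂ) * character L k x) • c k

/-- `c_{≤ q} = ∑_{p = -1}^{q} c_p`. -/
def lowPass (χ : E3 → ℝ) (L : ℝ) (q : ℤ) (c : Freq → C3) (x : E3) : C3 :=
  ∑ p ∈ Finset.Icc (-1 : ℤ) q, block χ L p c x

/-- `‖g‖_∞` for a continuous field `g`. -/
def supNorm (g : E3 → C3) : ℝ≥0∞ := ⨆ x, ‖g x‖ₑ

/-- `‖g‖₂²`, the integral being over the period cell. -/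
def l2Sq (L : ℝ) (g : E3 → C3) : ℝ≥0∞ := ∫⁻ x in cube L, ‖g x‖ₑ ^ 2

/-- `‖∇g‖_∞` for a `C¹` field `g`, with the Euclidean norm of the matrix `∇g(x)`. -/
def gradSupNorm (g : E3 → C3) : ℝ≥0∞ :=
  ⨆ x, (∑ j, ‖fderiv ℝ g x (EuclideanSpace.single j 1)‖ₑ ^ 2) ^ (1 / 2 : ℝ)

/-- `‖c‖²_{H^s} = ∑_{q ≥ -1} λ_q^{2s} ‖c_q‖₂²`; the summation index `n` stands for `q = n - 1`. -/
def sobolevSq (χ : E3 → ℝ) (L s : ℝ) (c : Freq → C3) : ℝ≥0∞ :=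
  ∑' n : ℕ, ENNReal.ofReal (lam L ((n : ℤ) - 1) ^ (2 * s)) * l2Sq L (block χ L ((n : ℤ) - 1) c)

/-- `CB` is a constant in Bernstein's inequality
`λ_q⁻¹ ‖v_q‖_∞² ≤ CB λ_q² ‖v_q‖₂²` for mean-zero fields on tori of arbitrary size. -/
def IsBernsteinConstant (χ : E3 → ℝ) (CB : ℝ) : Prop :=
  0 < CB ∧ ∀ L : ℝ, 0 < L → ∀ v : L2 L, coeff L v 0 = 0 → ∀ q : ℕ,
    ENNReal.ofReal ((lam L q)⁻¹) * supNorm (block χ L q (coeff L v)) ^ 2 ≤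
      ENNReal.ofReal (CB * lam L q ^ 2) * l2Sq L (block χ L q (coeff L v))

/-! ### Forces and Leray–Hopf solutions -/

/-- The time average `⟨g⟩(t) = T⁻¹ ∫_t^{t+T} g(τ) dτ` of a nonnegative function. -/
def timeAvg (T t : ℝ) (g : ℝ → ℝ≥0∞) : ℝ≥0∞ :=
  (ENNReal.ofReal T)⁻¹ * ∫⁻ τ in Icc t (t + T), g τ

/-- `‖f‖²_{L²_b(T)} = sup_t T⁻¹ ∫_t^{t+T} ‖f(τ)‖²_{H⁻¹} dτ`. -/
def forceBoundSq (χ : E3 → ℝ) (L T : ℝ) (f : ℝ → Freq → C3) : ℝ≥0∞ :=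
  ⨆ t : ℝ, timeAvg T t (fun τ => sobolevSq χ L (-1) (f τ))

/-- A real, mean-zero force that is translationally bounded in `L²_loc(ℝ; H⁻¹)`; each `f(t)` is a
periodic distribution, given by its Fourier coefficients. -/
structure IsForce (χ : E3 → ℝ) (L T : ℝ) (f : ℝ → Freq → C3) : Prop where
  measurable : ∀ k, AEStronglyMeasurable (fun t => f t k) volume
  real : ∀ t k i, f t (-k) i = star (f t k i)
  mean_zero : ∀ t, f t 0 = 0
  bounded : forceBoundSq χ L T f < ⊤

/-- Space-time test fields: smooth, spatially periodic, divergence free, with support compact in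
the time interval `(0, ∞)`. -/
structure IsTestField (L : ℝ) (φ : ℝ → E3 → E3) : Prop where
  smooth : ContDiff ℝ ∞ (fun p : ℝ × E3 => φ p.1 p.2)
  periodic : ∀ t, Periodic L (φ t)
  support : ∃ a b : ℝ, 0 < a ∧ ∀ t, t ∉ Icc a b → φ t = 0
  div_free : ∀ t x, ∑ j, fderiv ℝ (φ t) x (EuclideanSpace.single j 1) j = 0

/-- `v` has mean zero over the torus and is divergence free in the sense of distributions. -/
def IsSolenoidal (L : ℝ) (v : L2 L) : Prop :=
  (∫ x in cube L, v x) = 0 ∧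
  ∀ ψ : E3 → ℝ, ContDiff ℝ ∞ ψ → Periodic L ψ → ∫ x in cube L, inner ℝ (v x) (gradient ψ x) = 0

/-- Mean-zero weak solutions on `[0,∞)` of `u_t + (u·∇)u - νΔu + ∇p = f`, `∇·u = 0`. The pressure
is eliminated by testing against divergence-free fields. -/
structure IsWeakSolution (L ν : ℝ) (f : ℝ → Freq → C3) (u : ℝ → L2 L) : Prop where
  weakly_continuous : ∀ g : L2 L, ContinuousOn (fun t => inner ℝ g (u t)) (Ici 0)
  locally_H1 : ∀ a b : ℝ, 0 < a → ∫⁻ τ in Icc a b, gradSq L (u τ) < ⊤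
  solenoidal : ∀ t, 0 ≤ t → IsSolenoidal L (u t)
  equation : ∀ φ : ℝ → E3 → E3, IsTestField L φ →
    (∫ t in Ioi (0 : ℝ),
      ((∫ x in cube L,
          (inner ℝ (u t x) (deriv (fun s => φ s x) t)
            + inner ℝ (u t x) (fderiv ℝ (φ t) x (u t x))
            + ν * inner ℝ (u t x) (Laplacian.laplacian (φ t) x)))
        + pairing L (f t) (coeff L (φ t)))) = 0

/-- Leray–Hopf solutions on `[0,∞)`: weak solutions satisfying the energy inequality from almost
every initial time `t₀ > 0`. -/
structure IsLerayHopf (L ν : ℝ) (f : ℝ → Freq → C3) (u : ℝ → L2 L) : Prop extends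
    IsWeakSolution L ν f u where
  energy : ∀ᵐ t₀ ∂(volume.restrict (Ioi (0 : ℝ))), ∀ t, t₀ < t →
    1 / 2 * ‖u t‖ ^ 2 ≤ 1 / 2 * ‖u t₀‖ ^ 2
      - ν * (∫ τ in t₀..t, (gradSq L (u τ)).toReal)
      + ∫ τ in t₀..t, pairing L (f τ) (coeff L (u τ))

/-- Complete Leray–Hopf solutions: every time shift is a Leray–Hopf solution on `[0,∞)` (for the
correspondingly shifted force). -/
def IsCompleteLerayHopf (L ν : ℝ) (f : ℝ → Freq → C3) (u : ℝ → L2 L) : Prop :=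
  ∀ s : ℝ, IsLerayHopf L ν (fun t => f (t - s)) (fun t => u (t - s))

/-- Boundedness in `L²`, uniformly in time. -/
def IsBoundedL2 (L : ℝ) (u : ℝ → L2 L) : Prop := ∃ R : ℝ, ∀ t, ‖u t‖ ≤ R

/-! ### The determining wavenumber -/

/-- The indices `q` admissible in the definition of the determining wavenumber of `v`:
`(L λ_{p-q})^{(δ-1)/2} λ_q⁻¹ ‖v_p‖_∞ < c₀ν` for all `p > q`, and `λ_q⁻² ‖∇v_{≤q}‖_∞ < c₀ν`. -/
def IsAdmissible (χ : E3 → ℝ) (L ν δ c₀ : ℝ) (v : E3 → E3) (q : ℕ) : Prop :=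
  (∀ p : ℕ, q < p →
    ENNReal.ofReal ((L * lam L ((p : ℤ) - q)) ^ ((δ - 1) / 2) * (lam L q)⁻¹) *
      supNorm (block χ L p (coeff L v)) < ENNReal.ofReal (c₀ * ν)) ∧
  ENNReal.ofReal ((lam L q ^ 2)⁻¹) * gradSupNorm (lowPass χ L q (coeff L v)) <
    ENNReal.ofReal (c₀ * ν)

/-- The determining wavenumber `Λ_v = min {λ_q : q ∈ ℕ admissible}`, meaningful if an admissible
index exists. -/
def detWavenumber (χ : E3 → ℝ) (L ν δ c₀ : ℝ) (v : E3 → E3) : ℝ :=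
  sInf {l : ℝ | ∃ q : ℕ, IsAdmissible χ L ν δ c₀ v q ∧ l = lam L q}

/-! ### Intermittency dimension, Kolmogorov's wavenumber, Grashof numbers -/

open Classical in
/-- The intermittency dimension `d(u,t)`: the supremum of all real `s` with
`⟨∑_q λ_q^{-1+s} ‖u_q‖_∞²⟩ ≤ CB^{3-s} λ₀^s ⟨∑_q λ_q² ‖u_q‖₂²⟩` (`q ≥ -1`), and `3` if `u`
vanishes on `[t,t+T]`. -/
def intermittencyDim (χ : E3 → ℝ) (CB L T : ℝ) (u : ℝ → L2 L) (t : ℝ) : ℝ :=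
  if ∀ τ ∈ Icc t (t + T), u τ = 0 then 3 else
    sSup {s : ℝ |
      timeAvg T t (fun τ => ∑' n : ℕ, ENNReal.ofReal (lam L ((n : ℤ) - 1) ^ (-1 + s)) *
          supNorm (block χ L ((n : ℤ) - 1) (coeff L (u τ))) ^ 2) ≤
        ENNReal.ofReal (CB ^ (3 - s) * lam L 0 ^ s) *
          timeAvg T t (fun τ => sobolevSq χ L 1 (coeff L (u τ)))}

/-- `ε = ν λ₀^d ⟨‖∇u‖₂²⟩`, with `d` the intermittency dimension. -/
def dissipationRate (χ : E3 → ℝ) (CB L ν T : ℝ) (u : ℝ → L2 L) (t : ℝ) : ℝ :=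
  ν * lam L 0 ^ intermittencyDim χ CB L T u t * (timeAvg T t (fun τ => gradSq L (u τ))).toReal

/-- Kolmogorov's dissipation wavenumber `κ_d = (ε/ν³)^{1/(d+1)}`. -/
def kolmogorovWavenumber (χ : E3 → ℝ) (CB L ν T : ℝ) (u : ℝ → L2 L) (t : ℝ) : ℝ :=
  (dissipationRate χ CB L ν T u t / ν ^ 3) ^ (1 / (intermittencyDim χ CB L T u t + 1))

/-- `κ₀ = 2π λ₀ = 2π/L`. -/
def kappa0 (L : ℝ) : ℝ := 2 * Real.pi / L

/-- The Grashof number of a translationally bounded force,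
`G = T^{1/2} κ₀^{1/2} ‖f‖_{L²_b(T)} / (ν^{3/2} (1 - e^{-νκ₀²T})^{1/2})`. -/
def grashof (χ : E3 → ℝ) (L ν T : ℝ) (f : ℝ → Freq → C3) : ℝ :=
  T ^ (1 / 2 : ℝ) * kappa0 L ^ (1 / 2 : ℝ) * Real.sqrt (forceBoundSq χ L T f).toReal /
    (ν ^ (3 / 2 : ℝ) * (1 - Real.exp (-(ν * kappa0 L ^ 2 * T))) ^ (1 / 2 : ℝ))

/-- The Grashof number of a time-independent force, `G = ‖f‖_{H⁻¹} / (ν² κ₀^{1/2})`. -/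
def grashofAutonomous (χ : E3 → ℝ) (L ν : ℝ) (f₀ : Freq → C3) : ℝ :=
  Real.sqrt (sobolevSq χ L (-1) f₀).toReal / (ν ^ 2 * kappa0 L ^ (1 / 2 : ℝ))

end NSE

end

/-!
# The determining wavenumber in the case of intermittency dimension three

Write `S(τ) = ∑_m λ_m² ‖u_m(τ)‖_∞²` (`supSq`). Three facts give the theorem.

* *Pointwise in time*, an index `q` can only fail to be admissible if `(c₀ν λ_q²)² ≲ (q + 1) S`
  (`le_of_not_isAdmissible`). If the first condition fails for some `p > q`, then `δ ≤ 3` gives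
  `c₀ν λ_q² ≤ λ_p ‖u_p‖_∞`. If the second one fails, then Bernstein's inequality
  `‖∇u_p‖_∞ ≲ λ_p ‖u_p‖_∞` and the Cauchy–Schwarz inequality over the `q + 1` blocks of `u_{≤q}`
  apply; the latter is where the logarithm comes from. Applied to the index below the least
  admissible one, this reads `((Λ - λ₀) / log(Λ/λ₀)^{1/4})⁴ ≲ ν⁻² S`
  (`excess_nonneg_and_pow_four_le`). Bernstein's inequality is proved without convolution kernels:
  multiplication by the frequency coincides on a bounded range with a triangle wave, so that the
  derivative is an absolutely convergent combination of translates (`norm_sum_intCast_smul_le`).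

* *The dimension.* If `d = 3`, the defining inequality holds in the limit `s → 3`, that is
  `⟨S⟩ ≤ λ₀³ ⟨‖u‖²_{H¹}⟩` (`timeAvg_supSq_le`). As `‖u‖_{H¹} ≲ ‖∇u‖₂`, the right-hand side is a
  multiple of `ν² κ_d⁴`. In particular `S` is finite almost everywhere, and Jensen's inequality for
  the fourth power yields the first inequality (`average_excess_le`).

* *The energy.* The energy inequality, with `(f, u) ≤ ν/2 ‖∇u‖₂² + (2ν)⁻¹ ‖f‖²_{H⁻¹}` and Poincaré's
  inequality, bounds `⟨‖∇u‖₂²⟩` by the force (`IsCompleteLerayHopf.timeAvg_gradSq_le`). Gronwall's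
  inequality is not needed, because the solution is complete and bounded: the supremum `M` of `‖u‖²`
  is compared with itself, since over a time `~ 1/(νκ₀²)` dissipation forces a value at most `M/2`
  plus the contribution of the force. The numerical constants lost in this way are
  compensated by the factor `(2π)³` between `λ₀³` and `κ₀³`.

Poincaré's inequality rests on Parseval's identity for `L²` of the period cell, which is transported
from the unit torus (`map_fromTorus`, `parseval`). Weak continuity of `u` makes its Fourier
coefficients continuous in time, hence all suprema above lower semicontinuous and the determining
wavenumber measurable.
-/

noncomputable section

namespace NSE

/-! ### Fourier series on the torus -/

section Torus

/-- The Haar probability measure on `ℝ / ℤ`, the normalization for which Mathlib proves Parseval's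
identity on the unit torus. -/
local instance unitCircleMeasure : MeasureSpace UnitAddCircle := ⟨AddCircle.haarAddCircle⟩

local instance unitCircleHaar : Measure.IsAddHaarMeasure (volume : Measure UnitAddCircle) :=
  inferInstanceAs (Measure.IsAddHaarMeasure AddCircle.haarAddCircle)

local instance unitCircleProb : IsProbabilityMeasure (volume : Measure UnitAddCircle) :=
  inferInstanceAs (IsProbabilityMeasure AddCircle.haarAddCircle)

/-- The parametrization of the period cell by the unit torus: each coordinate is represented in
`(0, 1]` and scaled by `L`. -/
def fromTorus (L : ℝ) (y : UnitAddTorus (Fin 3)) : E3 :=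
  L • WithLp.toLp 2 (fun i => ((AddCircle.equivIoc (1 : ℝ) 0 (y i)).1 : ℝ))

lemma measurable_fromTorus (L : ℝ) : Measurable (fromTorus L) := by
  have h : Measurable fun y : UnitAddTorus (Fin 3) =>
      (fun i => ((AddCircle.equivIoc (1 : ℝ) 0 (y i)).1 : ℝ)) := by
    refine measurable_pi_lambda _ fun i => ?_
    exact measurable_subtype_coe.comp
      ((AddCircle.measurableEquivIoc 1 0).measurable.comp (measurable_pi_apply i))
  exact (((WithLp.measurable_toLp 2 _).comp h)).const_smul L

lemma cube_ae_eq (L : ℝ) :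
    ({x : E3 | ∀ i, x i ∈ Ioc (0 : ℝ) L} : Set E3) =ᵐ[volume] cube L := by
  have h : (Set.pi univ fun _ : Fin 3 => Ioc (0 : ℝ) L) =ᵐ[volume]
      Set.pi univ fun _ : Fin 3 => Icc (0 : ℝ) L := by
    rw [Set.pi_univ_Icc]
    exact Measure.univ_pi_Ioc_ae_eq_Icc
  have h2 := (PiLp.volume_preserving_ofLp (Fin 3)).quasiMeasurePreserving.preimage_ae_eq h
  have e1 : {x : E3 | ∀ i, x i ∈ Ioc (0 : ℝ) L} =
      WithLp.ofLp ⁻¹' Set.pi univ fun _ : Fin 3 => Ioc (0 : ℝ) L := by ext x; simp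
  have e2 : cube L = WithLp.ofLp ⁻¹' Set.pi univ fun _ : Fin 3 => Icc (0 : ℝ) L := by
    ext x; simp [cube, Set.mem_pi, -Set.pi_univ_Icc]
  rw [e1, e2]
  exact h2

lemma map_fromTorus {L : ℝ} (hL : 0 < L) :
    Measure.map (fromTorus L) volume =
      ENNReal.ofReal ((L ^ 3)⁻¹) • (volume : Measure E3).restrict (cube L) := by
  have hS : MeasurableSet {x : E3 | ∀ i, x i ∈ Ioc (0 : ℝ) 1} := by
    have : {x : E3 | ∀ i, x i ∈ Ioc (0 : ℝ) 1} = ⋂ i, (fun x : E3 => x i) ⁻¹' Ioc (0 : ℝ) 1 := by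
      ext; simp
    rw [this]
    exact MeasurableSet.iInter fun i => measurableSet_Ioc.preimage (by fun_prop)
  have hSL : MeasurableSet {x : E3 | ∀ i, x i ∈ Ioc (0 : ℝ) L} := by
    have : {x : E3 | ∀ i, x i ∈ Ioc (0 : ℝ) L} = ⋂ i, (fun x : E3 => x i) ⁻¹' Ioc (0 : ℝ) L := by
      ext; simp
    rw [this]
    exact MeasurableSet.iInter fun i => measurableSet_Ioc.preimage (by fun_prop)
  have hpi : MeasurableSet {x : Fin 3 → ℝ | ∀ i, x i ∈ Ioc (0 : ℝ) (0 + 1)} := by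
    exact MeasurableSet.univ_pi' fun i => measurableSet_Ioc
  have h1 : Measure.map (fun y : UnitAddTorus (Fin 3) =>
      (fun i => ((AddCircle.equivIoc (1 : ℝ) 0 (y i)).1 : ℝ))) volume =
      volume.restrict {x : Fin 3 → ℝ | ∀ i, x i ∈ Ioc (0 : ℝ) (0 + 1)} := by
    have := (UnitAddTorus.measurePreserving_equivPiIoc (d := Fin 3) 0).map_eq
    have h2 := congrArg (Measure.map Subtype.val) this
    rw [Measure.map_map measurable_subtype_coe (MeasurableEquiv.measurable _)] at h2
    refine Eq.trans ?_ (h2.trans (map_comap_subtype_coe ?_ volume))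
    · rfl
    · exact hpi
  have h3 : Measure.map (WithLp.toLp 2) (volume.restrict
      {x : Fin 3 → ℝ | ∀ i, x i ∈ Ioc (0 : ℝ) (0 + 1)}) =
      (volume : Measure E3).restrict {x : E3 | ∀ i, x i ∈ Ioc (0 : ℝ) 1} := by
    have := Measure.restrict_map (μ := (volume : Measure (Fin 3 → ℝ)))
      (WithLp.measurable_toLp 2 (Fin 3 → ℝ)) hS
    rw [(PiLp.volume_preserving_toLp (Fin 3)).map_eq] at this
    rw [this]
    simp
  have h4 : Measure.map (fun x : E3 => L • x)
      ((volume : Measure E3).restrict {x : E3 | ∀ i, x i ∈ Ioc (0 : ℝ) 1}) =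
      ENNReal.ofReal ((L ^ 3)⁻¹) •
        (volume : Measure E3).restrict {x : E3 | ∀ i, x i ∈ Ioc (0 : ℝ) L} := by
    have := Measure.restrict_map (μ := (volume : Measure E3))
      (measurable_const_smul L : Measurable fun x : E3 => L • x) hSL
    rw [Measure.map_addHaar_smul volume hL.ne', Measure.restrict_smul] at this
    have hf : Module.finrank ℝ E3 = 3 := by simp
    rw [hf, abs_of_pos (by positivity)] at this
    rw [this]
    congr 2
    ext x
    simp only [mem_ofPred_eq, mem_preimage, PiLp.smul_apply, smul_eq_mul, mem_Ioc]
    refine forall_congr' fun i => ?_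
    constructor
    · rintro ⟨h1, h2⟩; exact ⟨by positivity, by nlinarith⟩
    · rintro ⟨h1, h2⟩; exact ⟨by nlinarith [pos_of_mul_pos_right h1 hL.le], by nlinarith⟩
  have hm : Measurable fun y : UnitAddTorus (Fin 3) =>
      (fun i => ((AddCircle.equivIoc (1 : ℝ) 0 (y i)).1 : ℝ)) := by
    refine measurable_pi_lambda _ fun i => ?_
    exact measurable_subtype_coe.comp
      ((AddCircle.measurableEquivIoc 1 0).measurable.comp (measurable_pi_apply i))
  rw [← Measure.restrict_congr_set (cube_ae_eq L), ← h4, ← h3, ← h1,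
    Measure.map_map (WithLp.measurable_toLp 2 _) hm,
    Measure.map_map (measurable_const_smul L) ((WithLp.measurable_toLp 2 _).comp hm)]
  rfl

lemma character_fromTorus {L : ℝ} (hL : 0 < L) (k : Freq) (y : UnitAddTorus (Fin 3)) :
    character L k (fromTorus L y) = UnitAddTorus.mFourier k y := by
  have hy : y = fun i => (((AddCircle.equivIoc (1 : ℝ) 0 (y i)).1 : ℝ) : UnitAddCircle) := by
    ext i
    exact ((AddCircle.equivIoc (1 : ℝ) 0).symm_apply_apply (y i)).symm
  conv_rhs => rw [hy]
  simp only [UnitAddTorus.mFourier, ContinuousMap.coe_mk, fourier_coe_apply, ← Complex.exp_sum,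
    character]
  congr 1
  simp only [dot, fromTorus, PiLp.smul_apply, smul_eq_mul]
  push_cast
  rw [Finset.mul_sum, Finset.mul_sum]
  refine Finset.sum_congr rfl fun i _ => ?_
  have : (L : ℂ) ≠ 0 := by exact_mod_cast hL.ne'
  field_simp

lemma integral_fromTorus {L : ℝ} (hL : 0 < L) {g : E3 → ℂ}
    (hg : AEStronglyMeasurable g (volume.restrict (cube L))) :
    ∫ y, g (fromTorus L y) = ((L ^ 3 : ℝ) : ℂ)⁻¹ * ∫ x in cube L, g x := by
  rw [← integral_map (φ := fromTorus L) (measurable_fromTorus L).aemeasurable, map_fromTorus hL,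
    integral_smul_measure]
  · rw [ENNReal.toReal_ofReal (by positivity), Complex.real_smul]
    push_cast; rfl
  · rw [map_fromTorus hL]
    exact hg.smul_measure _

lemma continuous_character (L : ℝ) (k : Freq) : Continuous (character L k) := by
  unfold character dot; fun_prop

lemma norm_character (L : ℝ) (k : Freq) (x : E3) : ‖character L k x‖ = 1 := by
  rw [character, mul_comm, Complex.norm_exp_ofReal_mul_I]

lemma character_mul (L : ℝ) (k l : Freq) (x : E3) :
    character L k x * character L l x = character L (k + l) x := by
  simp only [character, ← Complex.exp_add, ← mul_add, dot]
  congr 2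
  rw [← Complex.ofReal_add, ← mul_add, ← Finset.sum_add_distrib]
  simp [add_mul]

/-- The scalar Fourier coefficients on the period cell are those of the function transported to
the unit torus. -/
lemma mFourierCoeff_fromTorus {L : ℝ} (hL : 0 < L) {w : E3 → ℂ}
    (hw : AEStronglyMeasurable w (volume.restrict (cube L))) (k : Freq) :
    UnitAddTorus.mFourierCoeff (fun y => w (fromTorus L y)) k =
      ((L ^ 3 : ℝ) : ℂ)⁻¹ * ∫ x in cube L, character L (-k) x * w x := by
  rw [← integral_fromTorus hL (g := fun x => character L (-k) x * w x)
    ((continuous_character L (-k)).aestronglyMeasurable.mul hw)]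
  simp only [UnitAddTorus.mFourierCoeff, character_fromTorus hL, smul_eq_mul]

/-- Parseval's identity on the period cell for scalar functions. -/
lemma parseval_scalar {L : ℝ} (hL : 0 < L) {w : E3 → ℂ}
    (hw : MemLp w 2 (volume.restrict (cube L))) :
    ENNReal.ofReal (L ^ 3) * ∑' k : Freq,
      ‖((L ^ 3 : ℝ) : ℂ)⁻¹ * ∫ x in cube L, character L (-k) x * w x‖ₑ ^ 2 =
      ∫⁻ x in cube L, ‖w x‖ₑ ^ 2 := by
  have hmap := map_fromTorus hL
  have hw' : MemLp w 2 (Measure.map (fromTorus L) volume) := by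
    rw [hmap]; exact hw.smul_measure ENNReal.ofReal_ne_top
  have hW : MemLp (w ∘ fromTorus L) 2 volume :=
    hw'.comp_of_map (measurable_fromTorus L).aemeasurable
  have hcoe := hW.coeFn_toLp
  have hcoeff : ∀ k, UnitAddTorus.mFourierCoeff (hW.toLp _) k =
      ((L ^ 3 : ℝ) : ℂ)⁻¹ * ∫ x in cube L, character L (-k) x * w x := by
    intro k
    rw [← mFourierCoeff_fromTorus hL hw.1]
    refine integral_congr_ae ?_
    filter_upwards [hcoe] with y hy
    rw [hy]; rfl
  have h := UnitAddTorus.hasSum_sq_mFourierCoeff (hW.toLp _)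
  simp only [hcoeff] at h
  have hint : Integrable (fun y => ‖(w ∘ fromTorus L) y‖ ^ 2) volume :=
    hW.integrable_norm_pow two_ne_zero
  have h2 : ∫ t, ‖(hW.toLp (w ∘ fromTorus L)) t‖ ^ 2 = ∫ y, ‖(w ∘ fromTorus L) y‖ ^ 2 := by
    refine integral_congr_ae ?_
    filter_upwards [hcoe] with y hy
    rw [hy]
  rw [h2] at h
  have h3 := congrArg ENNReal.ofReal h.tsum_eq
  rw [ENNReal.ofReal_tsum_of_nonneg (fun _ => by positivity) h.summable,
    ofReal_integral_eq_lintegral_ofReal hint (Filter.Eventually.of_forall fun _ => by positivity)] at h3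
  simp only [ENNReal.ofReal_pow (norm_nonneg _), ofReal_norm] at h3
  rw [h3]
  have h4 : ∫⁻ y, ‖(w ∘ fromTorus L) y‖ₑ ^ 2 = ENNReal.ofReal ((L ^ 3)⁻¹) *
      ∫⁻ x in cube L, ‖w x‖ₑ ^ 2 := by
    rw [← smul_eq_mul, ← lintegral_smul_measure, ← hmap,
      lintegral_map' (hw'.1.enorm.pow_const 2) (measurable_fromTorus L).aemeasurable]
    rfl
  rw [h4, ← mul_assoc, ← ENNReal.ofReal_mul (by positivity), mul_inv_cancel₀ (by positivity)]
  simp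

lemma integral_character {L : ℝ} (hL : 0 < L) (k : Freq) :
    ((L ^ 3 : ℝ) : ℂ)⁻¹ * ∫ x in cube L, character L k x = if k = 0 then 1 else 0 := by
  rw [← integral_fromTorus hL (continuous_character L k).aestronglyMeasurable]
  simp only [character_fromTorus hL]
  have h := (orthonormal_iff_ite.mp (UnitAddTorus.orthonormal_mFourier (d := Fin 3))) 0 k
  rw [ContinuousMap.inner_toLp] at h
  simp only [UnitAddTorus.mFourier_zero] at h
  simpa [eq_comm] using h

end Torus

lemma enorm_sq_eq_sum (c : C3) : ‖c‖ₑ ^ 2 = ∑ i, ‖c i‖ₑ ^ 2 := by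
  have h : ‖c‖ ^ 2 = ∑ i, ‖c i‖ ^ 2 := EuclideanSpace.norm_sq_eq c
  have h2 := congrArg ENNReal.ofReal h
  rw [ENNReal.ofReal_sum_of_nonneg (fun _ _ => by positivity)] at h2
  simpa only [ENNReal.ofReal_pow (norm_nonneg _), ofReal_norm] using h2

lemma volume_cube_lt_top (L : ℝ) : volume (cube L) < ⊤ := by
  have hb : Bornology.IsBounded (cube L) := by
    refine (Metric.isBounded_closedBall (x := (0 : E3)) (r := Real.sqrt (∑ _i : Fin 3, L ^ 2))).subset
      fun x hx => ?_
    rw [mem_closedBall_zero_iff, EuclideanSpace.norm_eq]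
    refine Real.sqrt_le_sqrt (Finset.sum_le_sum fun i _ => ?_)
    have := hx i
    rw [Real.norm_eq_abs, sq_abs]
    exact pow_le_pow_left₀ this.1 this.2 2
  exact hb.measure_lt_top

instance isFiniteMeasure_cube (L : ℝ) : IsFiniteMeasure ((volume : Measure E3).restrict (cube L)) :=
  ⟨by rw [Measure.restrict_apply_univ]; exact volume_cube_lt_top L⟩

lemma memLp_component {L : ℝ} (v : L2 L) (i : Fin 3) :
    MemLp (fun x => ((v x i : ℝ) : ℂ)) 2 (volume.restrict (cube L)) := by
  have h := Lp.memLp v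
  refine h.of_le ?_ (Filter.Eventually.of_forall fun x => ?_)
  · exact (Complex.continuous_ofReal.comp
      (by fun_prop : Continuous fun y : E3 => y i)).comp_aestronglyMeasurable h.1
  · rw [Complex.norm_real]
    exact PiLp.norm_apply_le (v x) i

/-- Parseval's identity for square integrable fields: `‖v‖₂² = L³ ∑ₖ |v̂(k)|²`. -/
lemma parseval {L : ℝ} (hL : 0 < L) (v : L2 L) :
    ENNReal.ofReal (L ^ 3) * ∑' k : Freq, ‖coeff L v k‖ₑ ^ 2 = ENNReal.ofReal (‖v‖ ^ 2) := by
  have h1 : ∀ k, ‖coeff L v k‖ₑ ^ 2 = ∑ i, ‖((L ^ 3 : ℝ) : ℂ)⁻¹ *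
      ∫ x in cube L, character L (-k) x * ((v x i : ℝ) : ℂ)‖ₑ ^ 2 := fun k => enorm_sq_eq_sum _
  simp only [h1]
  rw [Summable.tsum_finsetSum (fun i _ => ENNReal.summable), Finset.mul_sum]
  simp only [parseval_scalar hL (memLp_component v _)]
  rw [← lintegral_finsetSum' _ (fun i _ => (memLp_component v i).1.enorm.pow_const 2)]
  have h2 : ‖v‖ ^ 2 = ∫ x in cube L, ‖v x‖ ^ 2 := by
    rw [← real_inner_self_eq_norm_sq, L2.inner_def]
    simp only [real_inner_self_eq_norm_sq]
  rw [h2, ofReal_integral_eq_lintegral_ofReal (Lp.memLp v).integrable_norm_pow'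
    (Filter.Eventually.of_forall fun _ => by positivity)]
  refine lintegral_congr fun x => ?_
  rw [EuclideanSpace.norm_sq_eq, ENNReal.ofReal_sum_of_nonneg (fun _ _ => by positivity)]
  refine Finset.sum_congr rfl fun i _ => ?_
  rw [ENNReal.ofReal_pow (norm_nonneg _), ← Complex.norm_real, ofReal_norm]

/-- Parseval's identity for vector-valued trigonometric polynomials. -/
lemma l2Sq_trigPoly {L : ℝ} (hL : 0 < L) (F : Finset Freq) (a : Freq → C3) :
    l2Sq L (fun x => ∑ k ∈ F, character L k x • a k) =
      ENNReal.ofReal (L ^ 3) * ∑ k ∈ F, ‖a k‖ₑ ^ 2 := by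
  have happ : ∀ (i : Fin 3) (x : E3), (∑ k ∈ F, character L k x • a k) i =
      ∑ k ∈ F, character L k x * a k i := by
    intro i x; simp
  have hcont : ∀ i : Fin 3, Continuous fun x => ∑ k ∈ F, character L k x * a k i := fun i =>
    continuous_finsetSum _ fun k _ => (continuous_character L k).mul continuous_const
  have hbd : ∀ i : Fin 3, MemLp (fun x => ∑ k ∈ F, character L k x * a k i) 2
      (volume.restrict (cube L)) := fun i => by
    refine MemLp.of_bound (hcont i).aestronglyMeasurable (∑ k ∈ F, ‖a k i‖)
      (Filter.Eventually.of_forall fun x => (norm_sum_le _ _).trans ?_)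
    simp [norm_character]
  have hco : ∀ (i : Fin 3) (l : Freq), ((L ^ 3 : ℝ) : ℂ)⁻¹ *
      ∫ x in cube L, character L (-l) x * ∑ k ∈ F, character L k x * a k i =
      if l ∈ F then a l i else 0 := by
    intro i l
    have e : ∀ x, character L (-l) x * ∑ k ∈ F, character L k x * a k i =
        ∑ k ∈ F, character L (-l + k) x * a k i := by
      intro x
      rw [Finset.mul_sum]
      exact Finset.sum_congr rfl fun k _ => by rw [← mul_assoc, character_mul]
    simp only [e]
    rw [integral_finsetSum]
    · rw [Finset.mul_sum]
      have : ∀ k ∈ F, ((L ^ 3 : ℝ) : ℂ)⁻¹ * ∫ x in cube L, character L (-l + k) x * a k i =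
          if l = k then a k i else 0 := by
        intro k _
        rw [integral_mul_const, ← mul_assoc, integral_character hL]
        simp only [neg_add_eq_zero]
        split_ifs <;> simp
      rw [Finset.sum_congr rfl this, Finset.sum_ite_eq]
    · intro k _
      refine Integrable.of_bound (C := ‖a k i‖) ((continuous_character L _).mul
        continuous_const).aestronglyMeasurable (Filter.Eventually.of_forall fun x => ?_)
      simp [norm_character]
  rw [l2Sq]
  simp only [enorm_sq_eq_sum, happ]
  rw [lintegral_finsetSum' _ (fun i _ => (hbd i).1.enorm.pow_const 2), Finset.sum_comm, Finset.mul_sum]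
  refine Finset.sum_congr rfl fun i _ => ?_
  rw [← parseval_scalar hL (hbd i)]
  simp only [hco]
  rw [tsum_eq_sum (s := F) (fun l hl => by simp [hl])]
  congr 1
  exact Finset.sum_congr rfl fun l hl => by simp [hl]

lemma coeff_zero_of_isSolenoidal {L : ℝ} {v : L2 L} (hv : IsSolenoidal L v) : coeff L v 0 = 0 := by
  have hint : Integrable (fun x => v x) (volume.restrict (cube L)) :=
    (Lp.memLp v).integrable one_le_two
  ext i
  have h : ∫ x in cube L, v x i = 0 := by
    have := (EuclideanSpace.proj (𝕜 := ℝ) i : E3 →L[ℝ] ℝ).integral_comp_comm hint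
    refine this.trans ?_
    rw [hv.1]; rfl
  have h0 : ∀ x, character L (-0) x = 1 := fun x => by simp [character, dot]
  simp only [coeff, h0, one_mul, integral_complex_ofReal, h]
  simp

/-! ### Littlewood–Paley symbols and Sobolev norms -/

lemma lam_pos {L : ℝ} (hL : 0 < L) (q : ℤ) : 0 < lam L q := by unfold lam; positivity

lemma norm_zpow_smul (q : ℤ) (ξ : E3) : ‖(2 : ℝ) ^ (-q) • ξ‖ = ‖ξ‖ / 2 ^ q := by
  rw [norm_smul, Real.norm_of_nonneg (by positivity), zpow_neg]; field_simp

lemma norm_half_zpow_smul (q : ℤ) (ξ : E3) :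
    ‖(2 : ℝ)⁻¹ • (2 : ℝ) ^ (-q) • ξ‖ = ‖ξ‖ / 2 ^ q / 2 := by
  rw [norm_smul, norm_zpow_smul, Real.norm_of_nonneg (by positivity)]; field_simp

lemma one_le_norm_freqVec {k : Freq} (hk : k ≠ 0) : 1 ≤ ‖freqVec k‖ := by
  obtain ⟨i, hi⟩ := Function.ne_iff.mp hk
  have h1 : (1 : ℝ) ≤ |(k i : ℝ)| := by exact_mod_cast Int.one_le_abs hi
  exact h1.trans (PiLp.norm_apply_le (freqVec k) i)

lemma symbol_natCast (χ : E3 → ℝ) (m : ℕ) (ξ : E3) :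
    symbol χ m ξ = χ ((2 : ℝ)⁻¹ • ((2 : ℝ) ^ (-(m : ℤ))) • ξ) - χ (((2 : ℝ) ^ (-(m : ℤ))) • ξ) := by
  rw [symbol, if_pos (by positivity)]

/-- The box of frequencies outside which the `m`-th Littlewood–Paley symbol vanishes. -/
def box (m : ℕ) : Finset Freq :=
  Fintype.piFinset fun _ => Finset.Icc (-(2 ^ (m + 1))) (2 ^ (m + 1))

variable {χ : E3 → ℝ}

lemma symbol_eq_zero_of_le (hχ : IsCutoff χ) {m : ℕ} {ξ : E3} (h : 2 ^ (m + 1) ≤ ‖ξ‖) :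
    symbol χ m ξ = 0 := by
  have h2 : (2 : ℝ) ^ m * 2 ≤ ‖ξ‖ := by rwa [pow_succ] at h
  have hp : (0 : ℝ) < 2 ^ m := by positivity
  rw [symbol_natCast, hχ.eq_zero, hχ.eq_zero, sub_zero]
  · rw [norm_zpow_smul, zpow_natCast, le_div_iff₀ hp]; linarith
  · rw [norm_half_zpow_smul, zpow_natCast, le_div_iff₀ two_pos, le_div_iff₀ hp]; linarith

lemma symbol_eq_zero_of_ge (hχ : IsCutoff χ) {m : ℕ} {ξ : E3} (h : ‖ξ‖ ≤ 2 ^ m / 2) :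
    symbol χ m ξ = 0 := by
  have hp : (0 : ℝ) < 2 ^ m := by positivity
  rw [symbol_natCast, hχ.eq_one, hχ.eq_one, sub_self]
  · rw [norm_zpow_smul, zpow_natCast, div_le_iff₀ hp]; linarith
  · rw [norm_half_zpow_smul, zpow_natCast, div_le_iff₀ two_pos, div_le_iff₀ hp]; linarith

lemma symbol_eq_zero_of_notMem_box (hχ : IsCutoff χ) {m : ℕ} {k : Freq} (h : k ∉ box m) :
    symbol χ m (freqVec k) = 0 := by
  apply symbol_eq_zero_of_le hχ
  simp only [box, Fintype.mem_piFinset, Finset.mem_Icc, ← abs_le, not_forall, not_le] at h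
  obtain ⟨i, hi⟩ := h
  have h1 : (2 : ℝ) ^ (m + 1) ≤ |(k i : ℝ)| := by exact_mod_cast hi.le
  exact h1.trans (PiLp.norm_apply_le (freqVec k) i)

lemma block_eq_sum (hχ : IsCutoff χ) (L : ℝ) (m : ℕ) (c : Freq → C3) :
    block χ L m c = fun x => ∑ k ∈ box m, character L k x • ((symbol χ m (freqVec k) : ℂ) • c k) := by
  ext1 x
  rw [block, tsum_eq_sum (s := box m)]
  · exact Finset.sum_congr rfl fun k _ => by rw [smul_smul, mul_comm]
  · intro k hk
    rw [symbol_eq_zero_of_notMem_box hχ hk]; simp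

lemma block_neg_one (hχ : IsCutoff χ) (L : ℝ) {c : Freq → C3} (hc : c 0 = 0) :
    block χ L (-1) c = 0 := by
  ext1 x
  rw [block]
  refine (tsum_congr fun k => ?_).trans tsum_zero
  rcases eq_or_ne k 0 with rfl | hk
  · rw [hc, smul_zero]
  · have : symbol χ (-1) (freqVec k) = 0 := by
      rw [symbol, if_neg (by norm_num)]
      exact hχ.eq_zero _ (one_le_norm_freqVec hk)
    rw [this]; simp

lemma l2Sq_block (hχ : IsCutoff χ) {L : ℝ} (hL : 0 < L) (m : ℕ) (c : Freq → C3) :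
    l2Sq L (block χ L m c) =
      ENNReal.ofReal (L ^ 3) * ∑' k, ENNReal.ofReal (symbol χ m (freqVec k) ^ 2) * ‖c k‖ₑ ^ 2 := by
  rw [block_eq_sum hχ, l2Sq_trigPoly hL, tsum_eq_sum (s := box m)]
  · congr 1
    refine Finset.sum_congr rfl fun k _ => ?_
    rw [enorm_smul, mul_pow, ← sq_abs, ENNReal.ofReal_pow (abs_nonneg _), ← Real.norm_eq_abs,
      ← Complex.norm_real, ofReal_norm]
  · intro k hk
    rw [symbol_eq_zero_of_notMem_box hχ hk]; simp

/-- The weight by which the Littlewood–Paley norm of `H^s` multiplies `|c_k|²`. -/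
def weight (χ : E3 → ℝ) (L s : ℝ) (k : Freq) : ℝ≥0∞ :=
  ∑' m : ℕ, ENNReal.ofReal (lam L m ^ (2 * s) * symbol χ m (freqVec k) ^ 2)

lemma sobolevSq_eq_tsum (hχ : IsCutoff χ) {L : ℝ} (hL : 0 < L) (s : ℝ) {c : Freq → C3}
    (hc : c 0 = 0) :
    sobolevSq χ L s c = ENNReal.ofReal (L ^ 3) * ∑' k, weight χ L s k * ‖c k‖ₑ ^ 2 := by
  rw [sobolevSq, tsum_eq_zero_add' ENNReal.summable]
  have h0 : l2Sq L (block χ L (((0 : ℕ) : ℤ) - 1) c) = 0 := by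
    have : (((0 : ℕ) : ℤ) - 1) = -1 := by norm_num
    rw [this, block_neg_one hχ L hc]; simp [l2Sq]
  have hs : ∀ m : ℕ, (((m + 1 : ℕ) : ℤ) - 1) = (m : ℤ) := fun m => by push_cast; ring
  simp only [h0, mul_zero, zero_add, hs, l2Sq_block hχ hL]
  simp only [weight, ← ENNReal.tsum_mul_right]
  rw [ENNReal.tsum_comm, ← ENNReal.tsum_mul_left]
  refine tsum_congr fun m => ?_
  rw [mul_left_comm, ← ENNReal.tsum_mul_left]
  congr 1
  refine tsum_congr fun k => ?_
  rw [← mul_assoc, ← ENNReal.ofReal_mul (by have := lam_pos hL m; positivity)]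

/-- At a nonzero frequency only two consecutive symbols are nonzero, and they add up to `1`. -/
lemma weight_eq (hχ : IsCutoff χ) (L s : ℝ) {k : Freq} (hk : k ≠ 0) :
    ∃ (N : ℕ) (ξ : E3), (2 : ℝ) ^ N ≤ ‖freqVec k‖ ∧ ‖freqVec k‖ < 2 ^ (N + 1) ∧
      weight χ L s k = ENNReal.ofReal (lam L N ^ (2 * s) * χ ξ ^ 2) +
        ENNReal.ofReal (lam L (N + 1 : ℕ) ^ (2 * s) * (1 - χ ξ) ^ 2) := by
  obtain ⟨N, hN1, hN2⟩ := exists_nat_pow_near (one_le_norm_freqVec hk) one_lt_two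
  refine ⟨N, (2 : ℝ)⁻¹ • ((2 : ℝ) ^ (-(N : ℤ))) • freqVec k, hN1, hN2, ?_⟩
  have hp : (0 : ℝ) < 2 ^ N := by positivity
  have hsN : symbol χ N (freqVec k) = χ ((2 : ℝ)⁻¹ • ((2 : ℝ) ^ (-(N : ℤ))) • freqVec k) := by
    rw [symbol_natCast, hχ.eq_zero (((2 : ℝ) ^ (-(N : ℤ))) • freqVec k), sub_zero]
    rwa [norm_zpow_smul, zpow_natCast, le_div_iff₀ hp, one_mul]
  have hsN1 : symbol χ (N + 1 : ℕ) (freqVec k) =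
      1 - χ ((2 : ℝ)⁻¹ • ((2 : ℝ) ^ (-(N : ℤ))) • freqVec k) := by
    rw [symbol_natCast, hχ.eq_one ((2 : ℝ)⁻¹ • _ • _)]
    · congr 1
      refine hχ.radial _ _ ?_
      rw [norm_zpow_smul, norm_half_zpow_smul, zpow_natCast, zpow_natCast, pow_succ]
      field_simp
    · rw [norm_half_zpow_smul, zpow_natCast, div_le_iff₀ two_pos, div_le_iff₀ (by positivity)]
      have : (0 : ℝ) < 2 ^ (N + 1) := by positivity
      linarith
  rw [weight, tsum_eq_sum (s := {N, N + 1}), Finset.sum_pair (Nat.ne_add_one N), hsN, hsN1]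
  intro m hm
  have hm' : m < N ∨ N + 2 ≤ m := by
    simp only [Finset.mem_insert, Finset.mem_singleton] at hm; omega
  have : symbol χ m (freqVec k) = 0 := by
    rcases hm' with h | h
    · exact symbol_eq_zero_of_le hχ ((pow_le_pow_right₀ one_le_two h).trans hN1)
    · refine symbol_eq_zero_of_ge hχ ?_
      have : (2 : ℝ) ^ (N + 2) ≤ 2 ^ m := pow_le_pow_right₀ one_le_two h
      rw [pow_succ] at this
      linarith
  rw [this]; simp

lemma lam_natCast (L : ℝ) (m : ℕ) : lam L m = 2 ^ m / L := by rw [lam, zpow_natCast]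

lemma exists_cutoff_bound (hχ : IsCutoff χ) : ∃ A : ℝ, 1 ≤ A ∧ ∀ ξ, χ ξ ≤ A := by
  have hc : HasCompactSupport χ := by
    refine HasCompactSupport.of_support_subset_isCompact (isCompact_closedBall (0 : E3) 1) ?_
    intro ξ hξ
    rw [mem_closedBall_zero_iff]
    by_contra! h
    exact hξ (hχ.eq_zero ξ h.le)
  obtain ⟨A, hA⟩ := hχ.smooth.continuous.bounded_above_of_compact_support hc
  exact ⟨max 1 A, le_max_left _ _, fun ξ => (le_abs_self _).trans ((hA ξ).trans (le_max_right _ _))⟩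

/-- The Littlewood–Paley norm of `H¹` is controlled by the gradient. -/
lemma exists_sobolevSq_one_le (hχ : IsCutoff χ) : ∃ K : ℝ, 0 < K ∧ ∀ (L : ℝ), 0 < L →
    ∀ v : E3 → E3, coeff L v 0 = 0 → sobolevSq χ L 1 (coeff L v) ≤ ENNReal.ofReal K * gradSq L v := by
  obtain ⟨A, hA1, hA⟩ := exists_cutoff_bound hχ
  refine ⟨2 * A ^ 2, by positivity, fun L hL v hv => ?_⟩
  rw [sobolevSq_eq_tsum hχ hL 1 hv, gradSq, mul_left_comm,
    ← ENNReal.tsum_mul_left (a := ENNReal.ofReal (2 * A ^ 2))]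
  refine mul_le_mul_right (ENNReal.tsum_le_tsum fun k => ?_) _
  rw [← mul_assoc]
  rcases eq_or_ne k 0 with rfl | hk
  · simp [hv]
  gcongr
  obtain ⟨N, ξ, h1, h2, h3⟩ := weight_eq hχ L 1 hk
  have hl : 0 < lam L N := lam_pos hL N
  have hl' : 0 < lam L (N + 1 : ℕ) := lam_pos hL _
  rw [h3, ← ENNReal.ofReal_add (by positivity) (by positivity), ← ENNReal.ofReal_mul (by positivity)]
  apply ENNReal.ofReal_le_ofReal
  have e : (2 * (1 : ℝ)) = (2 : ℕ) := by norm_num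
  rw [e, Real.rpow_natCast, Real.rpow_natCast]
  have ha0 := hχ.nonneg ξ
  have haA := hA ξ
  have hs1 : χ ξ ^ 2 ≤ A ^ 2 := by gcongr
  have hs2 : (1 - χ ξ) ^ 2 ≤ A ^ 2 := by
    exact sq_le_sq' (by linarith) (by linarith)
  have hr1 : lam L N ≤ ‖freqVec k‖ / L := by rw [lam_natCast]; gcongr
  have hr2 : lam L (N + 1 : ℕ) ≤ 2 * (‖freqVec k‖ / L) := by
    rw [lam_natCast, pow_succ, mul_comm, mul_div_assoc]; gcongr
  have hpi := Real.pi_gt_three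
  have hr0 : 0 ≤ ‖freqVec k‖ / L := by positivity
  set r := ‖freqVec k‖ / L
  have hX : 2 * Real.pi / L * ‖freqVec k‖ = 2 * Real.pi * r := by simp only [r]; ring
  rw [hX]
  have h5 : lam L N ^ 2 ≤ r ^ 2 := by gcongr
  have h6 : lam L (N + 1 : ℕ) ^ 2 ≤ (2 * r) ^ 2 := by gcongr
  have h7 : (6 * r) ^ 2 ≤ (2 * Real.pi * r) ^ 2 := by gcongr; linarith
  calc _ ≤ r ^ 2 * A ^ 2 + (2 * r) ^ 2 * A ^ 2 := by gcongr
    _ ≤ 2 * A ^ 2 * (6 * r) ^ 2 := by nlinarith [mul_nonneg (sq_nonneg r) (sq_nonneg A)]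
    _ ≤ _ := by gcongr

/-- The Littlewood–Paley norm of `H⁻¹` dominates the norm dual to the gradient. -/
lemma ofReal_inv_sq_le_weight (hχ : IsCutoff χ) {L : ℝ} (hL : 0 < L) {k : Freq} (hk : k ≠ 0) :
    ENNReal.ofReal (((2 * Real.pi / L * ‖freqVec k‖) ^ 2)⁻¹) ≤ weight χ L (-1) k := by
  obtain ⟨N, ξ, h1, h2, h3⟩ := weight_eq hχ L (-1) hk
  have hl : 0 < lam L N := lam_pos hL N
  have hl' : 0 < lam L (N + 1 : ℕ) := lam_pos hL _
  rw [h3, ← ENNReal.ofReal_add (by positivity) (by positivity)]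
  apply ENNReal.ofReal_le_ofReal
  have e : (2 * (-1 : ℝ)) = -(2 : ℕ) := by norm_num
  rw [e, Real.rpow_neg hl.le, Real.rpow_neg hl'.le, Real.rpow_natCast, Real.rpow_natCast]
  have hk1 : 0 < ‖freqVec k‖ := one_pos.trans_le (one_le_norm_freqVec hk)
  have hr1 : lam L N ≤ ‖freqVec k‖ / L := by rw [lam_natCast]; gcongr
  have hr2 : lam L (N + 1 : ℕ) ≤ 2 * (‖freqVec k‖ / L) := by
    rw [lam_natCast, pow_succ, mul_comm, mul_div_assoc]; gcongr
  have hr0 : 0 < ‖freqVec k‖ / L := by positivity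
  have hpi := Real.pi_gt_three
  set r := ‖freqVec k‖ / L
  have hX : 2 * Real.pi / L * ‖freqVec k‖ = 2 * Real.pi * r := by simp only [r]; ring
  rw [hX]
  have h5 : ((2 * r) ^ 2)⁻¹ ≤ (lam L N ^ 2)⁻¹ := by gcongr; linarith
  have h6 : ((2 * r) ^ 2)⁻¹ ≤ (lam L (N + 1 : ℕ) ^ 2)⁻¹ := by gcongr
  calc ((2 * Real.pi * r) ^ 2)⁻¹ ≤ ((6 * r) ^ 2)⁻¹ := by gcongr; linarith
    _ ≤ ((2 * r) ^ 2)⁻¹ * (χ ξ ^ 2 + (1 - χ ξ) ^ 2) := by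
      have : ((6 * r) ^ 2)⁻¹ = ((2 * r) ^ 2)⁻¹ * (1 / 9) := by field_simp; norm_num
      rw [this]
      gcongr
      nlinarith [sq_nonneg (χ ξ - 1 / 2)]
    _ ≤ _ := by rw [mul_add]; gcongr

/-! ### Bernstein's inequality for derivatives in the uniform norm -/

/-- The triangle wave that equals `y` for `|y| ≤ 1` and has period `4`, as a cosine series. -/
lemma hasSum_triangleWave {y : ℝ} (hy : |y| ≤ 1) :
    HasSum (fun n : ℕ => (1 - (-1) ^ n) / (n : ℝ) ^ 2 * Real.cos (2 * Real.pi * n * (1 / 4 + y / 4)))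
      (-(Real.pi ^ 2 / 4 * y)) := by
  rw [abs_le] at hy
  have h1 := hasSum_one_div_nat_pow_mul_cos (k := 1) one_ne_zero
    (x := 1 / 4 + y / 4) ⟨by linarith, by linarith⟩
  have h2 := hasSum_one_div_nat_pow_mul_cos (k := 1) one_ne_zero
    (x := 1 / 4 + y / 4 + 1 / 2) ⟨by linarith, by linarith⟩
  have h3 := h1.sub h2
  change HasSum _ (_ * bernoulliFun (2 * 1) _ - _ * bernoulliFun (2 * 1) _) at h3
  rw [mul_one, bernoulliFun_two, bernoulliFun_two] at h3
  convert h3 using 1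
  · ext1 n
    have : 2 * Real.pi * n * (1 / 4 + y / 4 + 1 / 2) =
      2 * Real.pi * n * (1 / 4 + y / 4) + n * Real.pi := by ring
    rw [this, Real.cos_add_nat_mul_pi]
    ring
  · simp [Nat.factorial]
    ring

/-- **Bernstein's inequality** for the derivative at `0` of a vector-valued trigonometric
polynomial: multiplication by the frequency agrees, on the frequencies that occur, with a triangle
wave, whose absolutely convergent Fourier series expresses the derivative by translates. -/
lemma norm_sum_intCast_smul_le {V ι : Type*} [NormedAddCommGroup V] [NormedSpace ℂ V]
    (F : Finset ι) (m : ι → ℤ) (a : ι → V) {N : ℝ} (hN : 0 < N) (hm : ∀ k ∈ F, |(m k : ℝ)| ≤ N)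
    {B : ℝ} (hB : ∀ s : ℝ, ‖∑ k ∈ F, Complex.exp ((m k * s : ℝ) * Complex.I) • a k‖ ≤ B) :
    ‖∑ k ∈ F, (m k : ℂ) • a k‖ ≤ 4 / 3 * N * B := by
  set P : ℝ → V := fun s => ∑ k ∈ F, Complex.exp ((m k * s : ℝ) * Complex.I) • a k with hP
  have hpi := Real.pi_pos
  set w : ℕ → ℝ := fun n => (1 - (-1) ^ n) / (n : ℝ) ^ 2 with hw
  have hterm : ∀ k ∈ F, HasSum (fun n : ℕ => ((-(4 * N / Real.pi ^ 2) * (w n / 2) : ℝ) : ℂ) •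
      (Complex.exp ((Real.pi * n / 2 : ℝ) * Complex.I) •
          Complex.exp ((m k * (2 * Real.pi * n / (4 * N)) : ℝ) * Complex.I) • a k +
        Complex.exp (-(Real.pi * n / 2 : ℝ) * Complex.I) •
          Complex.exp ((m k * -(2 * Real.pi * n / (4 * N)) : ℝ) * Complex.I) • a k))
      ((m k : ℂ) • a k) := by
    intro k hk
    have hy : |(m k : ℝ) / N| ≤ 1 := by
      rw [abs_div, abs_of_pos hN]; exact (div_le_one hN).2 (hm k hk)
    have h := (hasSum_triangleWave hy).mul_left (-(4 * N / Real.pi ^ 2))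
    have h2 := (Complex.hasSum_ofReal.2 h).smul_const (a k)
    convert h2 using 1
    · ext1 n
      rw [smul_smul, smul_smul, ← add_smul, smul_smul]
      congr 1
      rw [← Complex.exp_add, ← Complex.exp_add]
      push_cast
      rw [Complex.cos]
      have e1 : (Real.pi * n / 2 : ℂ) * Complex.I + m k * (2 * Real.pi * n / (4 * N)) * Complex.I =
          2 * Real.pi * n * (1 / 4 + m k / N / 4) * Complex.I := by ring
      have e2 : -(Real.pi * n / 2 : ℂ) * Complex.I + m k * -(2 * Real.pi * n / (4 * N)) * Complex.I =
          -(2 * Real.pi * n * (1 / 4 + m k / N / 4)) * Complex.I := by ring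
      rw [e1, e2]
      simp only [hw]
      push_cast
      ring
    · congr 1
      have : -(4 * N / Real.pi ^ 2) * -(Real.pi ^ 2 / 4 * (m k / N)) = (m k : ℝ) := by
        field_simp
      rw [this]; simp
  have hsum := hasSum_sum hterm
  have hbound : ∀ n : ℕ, ‖∑ k ∈ F, ((-(4 * N / Real.pi ^ 2) * (w n / 2) : ℝ) : ℂ) •
      (Complex.exp ((Real.pi * n / 2 : ℝ) * Complex.I) •
          Complex.exp ((m k * (2 * Real.pi * n / (4 * N)) : ℝ) * Complex.I) • a k +
        Complex.exp (-(Real.pi * n / 2 : ℝ) * Complex.I) •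
          Complex.exp ((m k * -(2 * Real.pi * n / (4 * N)) : ℝ) * Complex.I) • a k)‖ ≤
      8 * N / Real.pi ^ 2 * B * (1 / (n : ℝ) ^ 2) := by
    intro n
    rw [← Finset.smul_sum, Finset.sum_add_distrib, ← Finset.smul_sum, ← Finset.smul_sum]
    have hw2 : |w n| ≤ 2 * (1 / (n : ℝ) ^ 2) := by
      simp only [hw]
      rw [abs_div, abs_of_nonneg (sq_nonneg (n : ℝ)), mul_one_div]
      gcongr
      rcases neg_one_pow_eq_or ℝ n with h | h <;> rw [h] <;> norm_num
    have hA : ∀ (θ : ℝ) (s : ℝ), ‖Complex.exp (θ * Complex.I) • P s‖ ≤ B := fun θ s => by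
      rw [norm_smul, Complex.norm_exp_ofReal_mul_I, one_mul]; exact hB s
    have h1 := hA (Real.pi * n / 2) (2 * Real.pi * n / (4 * N))
    have h2 := hA (-(Real.pi * n / 2)) (-(2 * Real.pi * n / (4 * N)))
    rw [Complex.ofReal_neg] at h2
    have hB0 : 0 ≤ B := (norm_nonneg _).trans (hB 0)
    rw [norm_smul, Complex.norm_real, Real.norm_eq_abs, abs_mul, abs_neg, abs_div (w n),
      abs_of_pos (by positivity : 0 < 4 * N / Real.pi ^ 2), abs_two]
    calc _ ≤ 4 * N / Real.pi ^ 2 * (2 * (1 / (n : ℝ) ^ 2) / 2) * (B + B) := by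
          gcongr
          exact (norm_add_le _ _).trans (add_le_add h1 h2)
      _ = _ := by ring
  have hz := hasSum_zeta_two.mul_left (8 * N / Real.pi ^ 2 * B)
  refine (hsum.norm_le_of_bounded hz hbound).trans (le_of_eq ?_)
  field_simp
  ring

lemma contDiff_character (L : ℝ) (k : Freq) : ContDiff ℝ 1 (character L k) := by
  unfold character dot
  refine Complex.contDiff_exp.comp (contDiff_const.mul
    (Complex.ofRealCLM.contDiff.comp (contDiff_const.mul (ContDiff.sum fun j _ => ?_))))
  exact contDiff_const.mul (EuclideanSpace.proj (𝕜 := ℝ) j : E3 →L[ℝ] ℝ).contDiff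

lemma character_add_smul_single (L : ℝ) (k : Freq) (x : E3) (j : Fin 3) (t : ℝ) :
    character L k (x + t • EuclideanSpace.single j 1) =
      Complex.exp ((k j * (2 * Real.pi / L * t) : ℝ) * Complex.I) * character L k x := by
  have : dot k (x + t • EuclideanSpace.single j 1) = dot k x + k j * t := by
    simp [dot, mul_add, Finset.sum_add_distrib]
  rw [character, this, character, ← Complex.exp_add]
  congr 1
  push_cast
  ring

lemma contDiff_block (hχ : IsCutoff χ) (L : ℝ) (m : ℕ) (c : Freq → C3) :
    ContDiff ℝ 1 (block χ L m c) := by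
  rw [block_eq_sum hχ]
  exact ContDiff.sum fun k _ => (contDiff_character L k).smul contDiff_const

lemma block_add_smul_single (hχ : IsCutoff χ) (L : ℝ) (m : ℕ) (c : Freq → C3) (x : E3) (j : Fin 3)
    (t : ℝ) : block χ L m c (x + t • EuclideanSpace.single j 1) =
      ∑ k ∈ box m, Complex.exp ((k j * (2 * Real.pi / L * t) : ℝ) * Complex.I) •
        (character L k x • ((symbol χ m (freqVec k) : ℂ) • c k)) := by
  rw [block_eq_sum hχ]
  exact Finset.sum_congr rfl fun k _ => by rw [character_add_smul_single, mul_smul]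

lemma fderiv_block_single (hχ : IsCutoff χ) (L : ℝ) (m : ℕ) (c : Freq → C3) (x : E3) (j : Fin 3) :
    fderiv ℝ (block χ L m c) x (EuclideanSpace.single j 1) =
      (2 * Real.pi / L * Complex.I) • ∑ k ∈ box m, (k j : ℂ) •
        (character L k x • ((symbol χ m (freqVec k) : ℂ) • c k)) := by
  rw [← ((contDiff_block hχ L m c).differentiable one_ne_zero x).lineDeriv_eq_fderiv, lineDeriv]
  simp only [block_add_smul_single hχ]
  refine HasDerivAt.deriv ?_
  rw [Finset.smul_sum]
  refine HasDerivAt.fun_sum fun k _ => ?_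
  have h1 : HasDerivAt (fun t : ℝ => (k j * (2 * Real.pi / L * t) : ℝ))
      (k j * (2 * Real.pi / L)) 0 := by
    have := ((hasDerivAt_id (0 : ℝ)).const_mul (2 * Real.pi / L)).const_mul (k j : ℝ)
    simpa using this
  have h2 := ((h1.ofReal_comp.mul_const Complex.I).cexp).smul_const
    (character L k x • ((symbol χ m (freqVec k) : ℂ) • c k))
  convert h2 using 1
  rw [smul_smul (2 * Real.pi / L * Complex.I : ℂ)]
  congr 1
  push_cast
  simp
  ring

lemma supNorm_block_ne_top (hχ : IsCutoff χ) (L : ℝ) (m : ℕ) (c : Freq → C3) :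
    supNorm (block χ L m c) ≠ ⊤ := by
  have : supNorm (block χ L m c) ≤
      ENNReal.ofReal (∑ k ∈ box m, ‖(symbol χ m (freqVec k) : ℂ) • c k‖) := by
    refine iSup_le fun x => ?_
    rw [← ofReal_norm]
    refine ENNReal.ofReal_le_ofReal ?_
    rw [block_eq_sum hχ]
    refine (norm_sum_le _ _).trans (Finset.sum_le_sum fun k _ => ?_)
    rw [norm_smul, norm_character, one_mul]
  exact ne_top_of_le_ne_top ENNReal.ofReal_ne_top this

lemma norm_le_toReal_supNorm {g : E3 → C3} (hg : supNorm g ≠ ⊤) (x : E3) :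
    ‖g x‖ ≤ (supNorm g).toReal := by
  rw [← toReal_enorm]
  exact ENNReal.toReal_mono hg (le_iSup (fun x => ‖g x‖ₑ) x)

/-- Bernstein's inequality for the derivatives of a Littlewood–Paley block in the uniform norm. -/
lemma norm_fderiv_block_le (hχ : IsCutoff χ) {L : ℝ} (hL : 0 < L) (m : ℕ) (c : Freq → C3) (x : E3)
    (j : Fin 3) : ‖fderiv ℝ (block χ L m c) x (EuclideanSpace.single j 1)‖ ≤
      16 * Real.pi / 3 * (lam L m * (supNorm (block χ L m c)).toReal) := by
  have hpi := Real.pi_pos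
  rw [fderiv_block_single hχ, norm_smul]
  have h1 : ‖(2 * Real.pi / L * Complex.I : ℂ)‖ = 2 * Real.pi / L := by
    have : (2 * Real.pi / L : ℂ) = ((2 * Real.pi / L : ℝ) : ℂ) := by push_cast; rfl
    rw [norm_mul, Complex.norm_I, mul_one, this, Complex.norm_real,
      Real.norm_of_nonneg (by positivity)]
  have h2 := norm_sum_intCast_smul_le (box m) (fun k => k j)
    (fun k => character L k x • ((symbol χ m (freqVec k) : ℂ) • c k)) (N := 2 ^ (m + 1))
    (by positivity) (B := (supNorm (block χ L m c)).toReal) (fun k hk => by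
      simp only [box, Fintype.mem_piFinset, Finset.mem_Icc, ← abs_le] at hk
      exact_mod_cast hk j) (fun s => by
      have := block_add_smul_single hχ L m c x j (L / (2 * Real.pi) * s)
      have e : ∀ k : Freq, (k j * (2 * Real.pi / L * (L / (2 * Real.pi) * s)) : ℝ) = k j * s := by
        intro k; field_simp
      simp only [e] at this
      rw [← this]
      exact norm_le_toReal_supNorm (supNorm_block_ne_top hχ L m c) _)
  rw [h1]
  calc _ ≤ 2 * Real.pi / L * (4 / 3 * 2 ^ (m + 1) * (supNorm (block χ L m c)).toReal) := by gcongr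
    _ = _ := by rw [lam_natCast, pow_succ]; ring

lemma lowPass_eq_sum (hχ : IsCutoff χ) (L : ℝ) (q : ℕ) {c : Freq → C3} (hc : c 0 = 0) :
    lowPass χ L q c = fun x => ∑ m ∈ Finset.range (q + 1), block χ L m c x := by
  ext1 x
  have h : Finset.Icc (-1 : ℤ) q =
      insert (-1) ((Finset.range (q + 1)).map Nat.castEmbedding) := by
    ext p
    simp only [Finset.mem_Icc, Finset.mem_insert, Finset.mem_map, Finset.mem_range,
      Nat.castEmbedding_apply]
    constructor
    · rintro ⟨h1, h2⟩
      rcases eq_or_ne p (-1) with h | h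
      · exact Or.inl h
      · exact Or.inr ⟨p.toNat, by omega, by omega⟩
    · rintro (h | ⟨m, h1, h2⟩) <;> omega
  rw [lowPass, h, Finset.sum_insert, block_neg_one hχ L hc, Finset.sum_map]
  · simp
  · simp

lemma fderiv_lowPass (hχ : IsCutoff χ) (L : ℝ) (q : ℕ) {c : Freq → C3} (hc : c 0 = 0) (x v : E3) :
    fderiv ℝ (lowPass χ L q c) x v = ∑ m ∈ Finset.range (q + 1), fderiv ℝ (block χ L m c) x v := by
  rw [lowPass_eq_sum hχ L q hc, fderiv_fun_sum]
  · simp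
  · exact fun m _ => (contDiff_block hχ L m c).differentiable one_ne_zero x

lemma gradSupNorm_lowPass_le (hχ : IsCutoff χ) {L : ℝ} (hL : 0 < L) (q : ℕ) {c : Freq → C3}
    (hc : c 0 = 0) : gradSupNorm (lowPass χ L q c) ≤
      ENNReal.ofReal (32 * Real.pi / 3 *
        ∑ m ∈ Finset.range (q + 1), lam L m * (supNorm (block χ L m c)).toReal) := by
  have hpi := Real.pi_pos
  set D := 16 * Real.pi / 3 *
    ∑ m ∈ Finset.range (q + 1), lam L m * (supNorm (block χ L m c)).toReal with hD
  have hD0 : 0 ≤ D := mul_nonneg (by positivity)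
    (Finset.sum_nonneg fun m _ => mul_nonneg (lam_pos hL m).le ENNReal.toReal_nonneg)
  have hj : ∀ (x : E3) (j : Fin 3),
      ‖fderiv ℝ (lowPass χ L q c) x (EuclideanSpace.single j 1)‖ₑ ≤ ENNReal.ofReal D := by
    intro x j
    rw [← ofReal_norm]
    refine ENNReal.ofReal_le_ofReal ?_
    rw [fderiv_lowPass hχ L q hc, hD, Finset.mul_sum]
    exact (norm_sum_le _ _).trans (Finset.sum_le_sum fun m _ => norm_fderiv_block_le hχ hL m c x j)
  have h2D : 32 * Real.pi / 3 *
      ∑ m ∈ Finset.range (q + 1), lam L m * (supNorm (block χ L m c)).toReal = 2 * D := by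
    rw [hD]; ring
  rw [h2D]
  clear_value D
  refine iSup_le fun x => ?_
  calc _ ≤ (∑ _j : Fin 3, ENNReal.ofReal D ^ 2) ^ (1 / 2 : ℝ) := by
        gcongr with j; exact hj x j
    _ = ENNReal.ofReal ((3 * D ^ 2) ^ (1 / 2 : ℝ)) := by
        rw [← ENNReal.ofReal_rpow_of_nonneg (by positivity) (by norm_num),
          ENNReal.ofReal_mul (by norm_num), ENNReal.ofReal_pow hD0]
        simp
    _ ≤ _ := by
        refine ENNReal.ofReal_le_ofReal ?_
        rw [← Real.sqrt_eq_rpow]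
        refine (Real.sqrt_le_left (by linarith)).2 ?_
        nlinarith

/-! ### Admissible indices and the determining wavenumber -/

/-- The quantity `∑_m λ_m² ‖c_m‖_∞²`, the summation being over `m ≥ 0`. -/
def supSq (χ : E3 → ℝ) (L : ℝ) (c : Freq → C3) : ℝ≥0∞ :=
  ∑' m : ℕ, ENNReal.ofReal (lam L m ^ 2) * supNorm (block χ L m c) ^ 2

lemma sum_le_toReal_supSq (hχ : IsCutoff χ) (L : ℝ) {c : Freq → C3} (hS : supSq χ L c ≠ ⊤)
    (F : Finset ℕ) :
    ∑ m ∈ F, (lam L m * (supNorm (block χ L m c)).toReal) ^ 2 ≤ (supSq χ L c).toReal := by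
  have h := ENNReal.toReal_mono hS (ENNReal.sum_le_tsum F)
  rw [ENNReal.toReal_sum (fun m _ => ENNReal.mul_ne_top ENNReal.ofReal_ne_top
    (ENNReal.pow_ne_top (supNorm_block_ne_top hχ L m c)))] at h
  refine le_trans (le_of_eq (Finset.sum_congr rfl fun m _ => ?_)) h
  rw [ENNReal.toReal_mul, ENNReal.toReal_ofReal (sq_nonneg _), ENNReal.toReal_pow, mul_pow]

/-- An index `q` can only fail to be admissible if `λ_q⁴ ≲ (q + 1) ∑_m λ_m² ‖v_m‖_∞²`. The factor
`q + 1` comes from the Cauchy–Schwarz inequality in the bound for `∇v_{≤q}`. -/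
lemma le_of_not_isAdmissible (hχ : IsCutoff χ) {L ν δ c₀ : ℝ} (hL : 0 < L) (hν : 0 < ν)
    (hδ : δ ≤ 3) (hc₀ : 0 < c₀) {v : E3 → E3} (hv : coeff L v 0 = 0)
    (hS : supSq χ L (coeff L v) ≠ ⊤) {q : ℕ} (hq : ¬ IsAdmissible χ L ν δ c₀ v q) :
    (c₀ * ν * lam L q ^ 2) ^ 2 ≤
      (32 * Real.pi / 3) ^ 2 * ((q + 1) * (supSq χ L (coeff L v)).toReal) := by
  have hpi := Real.pi_gt_three
  have hl := lam_pos hL q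
  have hK : (1 : ℝ) ≤ 32 * Real.pi / 3 := by linarith
  have hcν : 0 < c₀ * ν := by positivity
  rw [IsAdmissible, not_and_or] at hq
  rcases hq with hq | hq
  · push Not at hq
    obtain ⟨p, hp, h⟩ := hq
    set b := (supNorm (block χ L p (coeff L v))).toReal with hb
    have hb0 : 0 ≤ b := ENNReal.toReal_nonneg
    rw [← ENNReal.ofReal_toReal (supNorm_block_ne_top hχ L p (coeff L v)), ← hb] at h
    have hLl : L * lam L ((p : ℤ) - q) = 2 ^ (p - q) := by
      rw [lam, ← Nat.cast_sub hp.le, zpow_natCast]; field_simp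
    rw [hLl, ← ENNReal.ofReal_mul (by positivity)] at h
    have h2 := (ENNReal.ofReal_le_ofReal_iff (by positivity)).1 h
    have h3 : ((2 : ℝ) ^ (p - q)) ^ ((δ - 1) / 2) ≤ 2 ^ (p - q) := by
      conv_rhs => rw [← Real.rpow_one ((2 : ℝ) ^ (p - q))]
      exact Real.rpow_le_rpow_of_exponent_le (one_le_pow₀ one_le_two) (by linarith)
    have h4 : (2 : ℝ) ^ (p - q) * lam L q = lam L p := by
      rw [lam_natCast, lam_natCast, mul_div_assoc', ← pow_add, Nat.sub_add_cancel hp.le]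
    have h5 : c₀ * ν * lam L q ^ 2 ≤ lam L p * b := by
      calc c₀ * ν * lam L q ^ 2 ≤ (2 ^ (p - q) * (lam L q)⁻¹ * b) * lam L q ^ 2 := by
            gcongr ?_ * _; exact h2.trans (by gcongr)
        _ = (2 ^ (p - q) * lam L q) * b := by field_simp
        _ = _ := by rw [h4]
    have h6 := sum_le_toReal_supSq hχ L hS {p}
    rw [Finset.sum_singleton, ← hb] at h6
    have hS0 : 0 ≤ (supSq χ L (coeff L v)).toReal := ENNReal.toReal_nonneg
    calc (c₀ * ν * lam L q ^ 2) ^ 2 ≤ (lam L p * b) ^ 2 := by gcongr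
      _ ≤ 1 * (1 * (supSq χ L (coeff L v)).toReal) := by simpa using h6
      _ ≤ _ := by
        gcongr
        · exact one_le_pow₀ hK
        · have : (0 : ℝ) ≤ q := by positivity
          linarith
  · rw [not_lt] at hq
    set A := ∑ m ∈ Finset.range (q + 1), lam L m * (supNorm (block χ L m (coeff L v))).toReal with hA
    have hA0 : 0 ≤ A := Finset.sum_nonneg fun m _ =>
      mul_nonneg (lam_pos hL m).le ENNReal.toReal_nonneg
    have h1 := hq.trans (mul_le_mul_right (gradSupNorm_lowPass_le hχ hL q hv) _)
    rw [← ENNReal.ofReal_mul (by positivity)] at h1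
    have h2 := (ENNReal.ofReal_le_ofReal_iff (by positivity)).1 h1
    have h3 : c₀ * ν * lam L q ^ 2 ≤ 32 * Real.pi / 3 * A := by
      rw [inv_mul_eq_div, le_div_iff₀ (by positivity)] at h2
      exact h2
    have h4 : A ^ 2 ≤ (q + 1) * (supSq χ L (coeff L v)).toReal := by
      have := sq_sum_le_card_mul_sum_sq (s := Finset.range (q + 1))
        (f := fun m : ℕ => lam L m * (supNorm (block χ L m (coeff L v))).toReal)
      rw [Finset.card_range] at this
      refine this.trans ?_
      push_cast
      gcongr
      exact sum_le_toReal_supSq hχ L hS _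
    calc (c₀ * ν * lam L q ^ 2) ^ 2 ≤ (32 * Real.pi / 3 * A) ^ 2 := by gcongr
      _ = (32 * Real.pi / 3) ^ 2 * A ^ 2 := by ring
      _ ≤ _ := by gcongr

lemma exists_isAdmissible (hχ : IsCutoff χ) {L ν δ c₀ : ℝ} (hL : 0 < L) (hν : 0 < ν)
    (hδ : δ ≤ 3) (hc₀ : 0 < c₀) {v : E3 → E3} (hv : coeff L v 0 = 0)
    (hS : supSq χ L (coeff L v) ≠ ⊤) : ∃ q, IsAdmissible χ L ν δ c₀ v q := by
  by_contra! hno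
  set S := (supSq χ L (coeff L v)).toReal
  have hS0 : 0 ≤ S := ENNReal.toReal_nonneg
  have hcν : 0 < c₀ * ν := by positivity
  have h : ∀ q : ℕ, (c₀ * ν) ^ 2 / L ^ 4 * 2 ^ q ≤ (32 * Real.pi / 3) ^ 2 * S := by
    intro q
    have h1 := le_of_not_isAdmissible hχ hL hν hδ hc₀ hv hS (hno q)
    rw [lam_natCast] at h1
    have h2 : ((q : ℝ) + 1) ≤ 2 ^ q := by
      have := @Nat.lt_two_pow_self q
      exact_mod_cast this
    have hp : (0 : ℝ) < 2 ^ q := by positivity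
    have h1p : (1 : ℝ) ≤ 2 ^ q := one_le_pow₀ one_le_two
    have h3 : (c₀ * ν) ^ 2 / L ^ 4 * 2 ^ q * 2 ^ q ≤ (32 * Real.pi / 3) ^ 2 * S * 2 ^ q := by
      calc _ ≤ (c₀ * ν) ^ 2 / L ^ 4 * 2 ^ q * 2 ^ q * (2 ^ q * 2 ^ q) :=
            le_mul_of_one_le_right (by positivity) (one_le_mul_of_one_le_of_one_le h1p h1p)
        _ = (c₀ * ν * (2 ^ q / L) ^ 2) ^ 2 := by field_simp
        _ ≤ _ := h1
        _ ≤ (32 * Real.pi / 3) ^ 2 * (2 ^ q * S) := by gcongr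
        _ = _ := by ring
    exact le_of_mul_le_mul_right h3 hp
  have ht : Filter.Tendsto (fun q : ℕ => (c₀ * ν) ^ 2 / L ^ 4 * (2 : ℝ) ^ q) Filter.atTop
      Filter.atTop :=
    (tendsto_pow_atTop_atTop_of_one_lt one_lt_two).const_mul_atTop (by positivity)
  obtain ⟨q, hq⟩ := (ht.eventually_gt_atTop ((32 * Real.pi / 3) ^ 2 * S)).exists
  exact absurd (h q) (not_le.2 hq)

/-- If the least admissible index is `n`, then `Λ_v = λ_n`. -/
lemma detWavenumber_eq {L ν δ c₀ : ℝ} (hL : 0 < L) {v : E3 → E3} {n : ℕ}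
    (hn : IsAdmissible χ L ν δ c₀ v n) (hmin : ∀ m < n, ¬ IsAdmissible χ L ν δ c₀ v m) :
    detWavenumber χ L ν δ c₀ v = lam L n := by
  refine IsLeast.csInf_eq ⟨⟨n, hn, rfl⟩, ?_⟩
  rintro l ⟨q, hq, rfl⟩
  have : n ≤ q := not_lt.1 fun h => hmin q h hq
  rw [lam_natCast, lam_natCast]
  gcongr
  exact one_le_two

/-- The time-averaged quantity of the theorem, for a single field. -/
def excess (χ : E3 → ℝ) (L ν δ c₀ : ℝ) (v : E3 → E3) : ℝ :=
  (detWavenumber χ L ν δ c₀ v - lam L 0) /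
    (Real.log (detWavenumber χ L ν δ c₀ v / lam L 0)) ^ (1 / 4 : ℝ)

/-- The pointwise estimate: at `n = log₂ (Λ_v / λ₀) ≥ 1` the index `n - 1` is not admissible, and
the logarithm absorbs the factor `n` of `le_of_not_isAdmissible`. -/
lemma excess_nonneg_and_pow_four_le (hχ : IsCutoff χ) {L ν δ c₀ : ℝ} (hL : 0 < L) (hν : 0 < ν)
    (hδ : δ ≤ 3) (hc₀ : 0 < c₀) {v : E3 → E3} (hv : coeff L v 0 = 0)
    (hS : supSq χ L (coeff L v) ≠ ⊤) :
    0 ≤ excess χ L ν δ c₀ v ∧ excess χ L ν δ c₀ v ^ 4 ≤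
      (16 * (32 * Real.pi / 3) ^ 2 / (Real.log 2 * c₀ ^ 2)) / ν ^ 2 *
        (supSq χ L (coeff L v)).toReal := by
  classical
  have hex := exists_isAdmissible hχ hL hν hδ hc₀ hv hS
  have hlog2 : 0 < Real.log 2 := Real.log_pos one_lt_two
  set S := (supSq χ L (coeff L v)).toReal
  have hS0 : 0 ≤ S := ENNReal.toReal_nonneg
  set n := Nat.find hex with hn
  rw [excess, detWavenumber_eq hL (Nat.find_spec hex) (fun m hm => Nat.find_min hex hm), ← hn]
  have hl0 : lam L 0 = 1 / L := by simp [lam]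
  have hlog : Real.log (lam L n / lam L 0) = n * Real.log 2 := by
    rw [hl0, lam_natCast, div_div_div_cancel_right₀ hL.ne', div_one, Real.log_pow]
  rw [hlog]
  rcases Nat.eq_zero_or_pos n with h0 | hpos
  · rw [h0]
    simp only [Nat.cast_zero, sub_self, zero_div, le_refl, true_and]
    rw [zero_pow four_ne_zero]
    positivity
  obtain ⟨r, hr⟩ : ∃ r, n = r + 1 := ⟨n - 1, by omega⟩
  have hadm := le_of_not_isAdmissible hχ hL hν hδ hc₀ hv hS (Nat.find_min hex (m := r) (by omega))
  have hln : lam L n = 2 * lam L r := by rw [hr, lam_natCast, lam_natCast, pow_succ]; ring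
  have hnpos : (0 : ℝ) < n := by exact_mod_cast hpos
  have hge : lam L 0 ≤ lam L n := by
    rw [hl0, lam_natCast]; gcongr; exact one_le_pow₀ one_le_two
  have hl0p : 0 < lam L 0 := lam_pos hL 0
  constructor
  · exact div_nonneg (by linarith) (by positivity)
  have h4 : ((n * Real.log 2) ^ (1 / 4 : ℝ)) ^ 4 = n * Real.log 2 := by
    rw [← Real.rpow_natCast, ← Real.rpow_mul (by positivity)]; norm_num
  rw [div_pow, h4]
  have hcast : (r : ℝ) + 1 = n := by rw [hr]; push_cast; ring
  rw [hcast] at hadm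
  rw [div_le_iff₀ (by positivity)]
  calc (lam L n - lam L 0) ^ 4 ≤ (2 * lam L r) ^ 4 := by
        gcongr
        linarith
    _ = 16 / (c₀ * ν) ^ 2 * (c₀ * ν * lam L r ^ 2) ^ 2 := by field_simp; ring
    _ ≤ 16 / (c₀ * ν) ^ 2 * ((32 * Real.pi / 3) ^ 2 * (n * S)) := by gcongr
    _ = _ := by field_simp

/-! ### Measurability in time -/

lemma integral_character_mul {L : ℝ} (v : L2 L) (k : Freq) (i : Fin 3) :
    ∫ x in cube L, character L k x * ((v x i : ℝ) : ℂ) =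
      ((∫ x in cube L, (character L k x).re * v x i : ℝ) : ℂ) +
        ((∫ x in cube L, (character L k x).im * v x i : ℝ) : ℂ) * Complex.I := by
  have hint : Integrable (fun x => character L k x * ((v x i : ℝ) : ℂ))
      (volume.restrict (cube L)) := by
    refine ((memLp_component v i).integrable one_le_two).bdd_mul
      (continuous_character L k).aestronglyMeasurable (c := 1)
      (Filter.Eventually.of_forall fun x => (norm_character L k x).le)
  rw [← integral_re_add_im hint]
  simp

/-- A weakly continuous curve in `L²` has continuous Fourier coefficients. -/
lemma continuous_coeff {L : ℝ} {u : ℝ → L2 L} (hu : ∀ g : L2 L, Continuous fun t => inner ℝ g (u t))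
    (k : Freq) : Continuous fun t => coeff L (u t) k := by
  have key : ∀ (w : E3 → ℝ) (i : Fin 3), Continuous w → (∀ x, |w x| ≤ 1) →
      Continuous fun t => ∫ x in cube L, w x * u t x i := by
    intro w i hw hb
    have hmem : MemLp (fun x => w x • (EuclideanSpace.single i (1 : ℝ) : E3)) 2
        (volume.restrict (cube L)) := by
      refine MemLp.of_bound (hw.smul continuous_const).aestronglyMeasurable 1
        (Filter.Eventually.of_forall fun x => ?_)
      rw [norm_smul, PiLp.norm_single, norm_one, mul_one]
      exact hb x
    convert hu (hmem.toLp _) using 1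
    ext1 t
    rw [L2.inner_def]
    refine integral_congr_ae ?_
    filter_upwards [hmem.coeFn_toLp] with x hx
    rw [hx, real_inner_smul_left, EuclideanSpace.inner_single_left]
    simp
  unfold coeff
  refine (PiLp.continuous_toLp 2 _).comp (continuous_pi fun i => ?_)
  simp only [integral_character_mul]
  refine continuous_const.mul (Continuous.add ?_ (Continuous.mul ?_ continuous_const))
  · exact Complex.continuous_ofReal.comp (key _ i (Complex.continuous_re.comp
      (continuous_character L (-k))) fun x => (Complex.abs_re_le_norm _).trans (norm_character _ _ _).le)
  · exact Complex.continuous_ofReal.comp (key _ i (Complex.continuous_im.comp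
      (continuous_character L (-k))) fun x => (Complex.abs_im_le_norm _).trans (norm_character _ _ _).le)

section

variable {L : ℝ} {c : ℝ → Freq → C3}

lemma measurable_supNorm_block (hχ : IsCutoff χ) (hc : ∀ k, Continuous fun t => c t k) (m : ℕ) :
    Measurable fun t => supNorm (block χ L m (c t)) := by
  refine LowerSemicontinuous.measurable (lowerSemicontinuous_iSup fun x => ?_)
  refine Continuous.lowerSemicontinuous ?_
  simp only [block_eq_sum hχ]
  refine Continuous.enorm ?_
  fun_prop

lemma measurable_supSq (hχ : IsCutoff χ) (hc : ∀ k, Continuous fun t => c t k) :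
    Measurable fun t => supSq χ L (c t) :=
  Measurable.tsum fun m => ((measurable_supNorm_block hχ hc m).pow_const 2).const_mul _

lemma measurable_gradSupNorm_lowPass (hχ : IsCutoff χ) (hc : ∀ k, Continuous fun t => c t k)
    (hc0 : ∀ t, c t 0 = 0) (q : ℕ) : Measurable fun t => gradSupNorm (lowPass χ L q (c t)) := by
  refine LowerSemicontinuous.measurable (lowerSemicontinuous_iSup fun x => ?_)
  refine Continuous.lowerSemicontinuous ?_
  simp only [fderiv_lowPass hχ L q (hc0 _), fderiv_block_single hχ]
  refine ENNReal.continuous_rpow_const.comp (continuous_finsetSum _ fun j _ => ?_)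
  refine (ENNReal.continuous_pow 2).comp (Continuous.enorm ?_)
  fun_prop

end

section

variable {L : ℝ} {u : ℝ → L2 L}

lemma measurable_gradSq (hc : ∀ k, Continuous fun t => coeff L (u t) k) :
    Measurable fun t => gradSq L (u t) :=
  (Measurable.tsum fun k =>
    (((hc k).enorm.measurable).pow_const 2).const_mul _).const_mul _

lemma measurableSet_isAdmissible (hχ : IsCutoff χ) (hc : ∀ k, Continuous fun t => coeff L (u t) k)
    (hc0 : ∀ t, coeff L (u t) 0 = 0) (ν δ c₀ : ℝ) (q : ℕ) :
    MeasurableSet {t | IsAdmissible χ L ν δ c₀ (u t) q} := by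
  have h : {t | IsAdmissible χ L ν δ c₀ (u t) q} =
      (⋂ (p : ℕ) (_ : q < p), {t |
        ENNReal.ofReal ((L * lam L ((p : ℤ) - q)) ^ ((δ - 1) / 2) * (lam L q)⁻¹) *
          supNorm (block χ L p (coeff L (u t))) < ENNReal.ofReal (c₀ * ν)}) ∩
      {t | ENNReal.ofReal ((lam L q ^ 2)⁻¹) * gradSupNorm (lowPass χ L q (coeff L (u t))) <
        ENNReal.ofReal (c₀ * ν)} := by
    ext t; simp [IsAdmissible]
  rw [h]
  refine (MeasurableSet.iInter fun p => MeasurableSet.iInter fun _ => ?_).inter ?_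
  · exact measurableSet_lt ((measurable_supNorm_block hχ hc p).const_mul _) measurable_const
  · exact measurableSet_lt ((measurable_gradSupNorm_lowPass hχ hc hc0 q).const_mul _)
      measurable_const

lemma aemeasurable_excess (hχ : IsCutoff χ) (hL : 0 < L)
    (hc : ∀ k, Continuous fun t => coeff L (u t) k)
    (hc0 : ∀ t, coeff L (u t) 0 = 0) (ν δ c₀ : ℝ) {μ : Measure ℝ}
    (hex : ∀ᵐ t ∂μ, ∃ q, IsAdmissible χ L ν δ c₀ (u t) q) :
    AEMeasurable (fun t => excess χ L ν δ c₀ (u t)) μ := by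
  classical
  have hA := measurableSet_isAdmissible hχ hc hc0 ν δ c₀
  -- Where no index is admissible every index qualifies, so that the least one exists everywhere.
  let P : ℝ → ℕ → Prop := fun t q =>
    IsAdmissible χ L ν δ c₀ (u t) q ∨ ¬ ∃ q, IsAdmissible χ L ν δ c₀ (u t) q
  have hP : ∀ t, ∃ q, P t q := fun t => by
    by_cases h : ∃ q, IsAdmissible χ L ν δ c₀ (u t) q
    · exact ⟨h.choose, Or.inl h.choose_spec⟩
    · exact ⟨0, Or.inr h⟩
  have hPm : ∀ q, MeasurableSet {t | P t q} := fun q => by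
    have : {t | P t q} = {t | IsAdmissible χ L ν δ c₀ (u t) q} ∪
        (⋃ q, {t | IsAdmissible χ L ν δ c₀ (u t) q})ᶜ := by
      ext t; simp [P]
    rw [this]
    exact (hA q).union (MeasurableSet.iUnion hA).compl
  have hfind : Measurable fun t => Nat.find (hP t) := measurable_find hP hPm
  have hF : Measurable fun n : ℕ => (lam L n - lam L 0) /
    (Real.log (lam L n / lam L 0)) ^ (1 / 4 : ℝ) := measurable_from_top
  refine ⟨_, hF.comp hfind, ?_⟩
  filter_upwards [hex] with t ht
  have hspec : IsAdmissible χ L ν δ c₀ (u t) (Nat.find (hP t)) :=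
    (Nat.find_spec (hP t)).resolve_right fun h => h ht
  have hdet := detWavenumber_eq hL hspec fun m hm h => Nat.find_min (hP t) hm (Or.inl h)
  rw [excess, hdet, Function.comp_apply]

end

/-! ### The intermittency dimension and time averages -/

section

variable {L : ℝ} {u : ℝ → L2 L}

lemma coeff_zero_field (hL : 0 < L) : coeff L (0 : L2 L) = 0 := by
  have h := parseval hL (0 : L2 L)
  have hL3 : ENNReal.ofReal (L ^ 3) ≠ 0 := by
    rw [Ne, ENNReal.ofReal_eq_zero, not_le]; positivity
  rw [norm_zero, zero_pow two_ne_zero, ENNReal.ofReal_zero, mul_eq_zero, or_iff_right hL3,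
    ENNReal.tsum_eq_zero] at h
  ext1 k
  simpa using h k

lemma timeAvg_mono {T t : ℝ} {g h : ℝ → ℝ≥0∞} (hgh : ∀ τ ∈ Icc t (t + T), g τ ≤ h τ) :
    timeAvg T t g ≤ timeAvg T t h :=
  mul_le_mul_right (setLIntegral_mono' measurableSet_Icc hgh) _

lemma timeAvg_tsum {T t : ℝ} {a : ℕ → ℝ≥0∞} {g : ℕ → ℝ → ℝ≥0∞} (hg : ∀ m, Measurable (g m)) :
    timeAvg T t (fun τ => ∑' m, a m * g m τ) = ∑' m, a m * timeAvg T t (g m) := by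
  rw [timeAvg, lintegral_tsum fun m => ((hg m).const_mul _).aemeasurable, ← ENNReal.tsum_mul_left]
  refine tsum_congr fun m => ?_
  rw [lintegral_const_mul _ (hg m), timeAvg, mul_left_comm]

/-- If the intermittency dimension is `3`, the inequality that defines it holds for `s = 3`: it
passes to the limit in each partial sum of its left-hand side. -/
lemma timeAvg_supSq_le (hχ : IsCutoff χ) {CB T t : ℝ} (hCB : 0 < CB) (hL : 0 < L)
    (hc : ∀ k, Continuous fun t => coeff L (u t) k)
    (hd : intermittencyDim χ CB L T u t = 3) :
    timeAvg T t (fun τ => supSq χ L (coeff L (u τ))) ≤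
      ENNReal.ofReal (lam L 0 ^ 3) * timeAvg T t (fun τ => sobolevSq χ L 1 (coeff L (u τ))) := by
  rw [intermittencyDim] at hd
  split_ifs at hd with h0
  · have : timeAvg T t (fun τ => supSq χ L (coeff L (u τ))) ≤ timeAvg T t (fun _ => 0) := by
      refine timeAvg_mono fun τ hτ => ?_
      rw [h0 τ hτ, coeff_zero_field hL]
      simp [supSq, supNorm, block]
    refine this.trans ?_
    simp [timeAvg]
  set B := timeAvg T t (fun τ => sobolevSq χ L 1 (coeff L (u τ)))
  set A : ℕ → ℝ≥0∞ := fun m => timeAvg T t fun τ => supNorm (block χ L m (coeff L (u τ))) ^ 2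
  set S : Set ℝ := {s : ℝ |
      timeAvg T t (fun τ => ∑' n : ℕ, ENNReal.ofReal (lam L ((n : ℤ) - 1) ^ (-1 + s)) *
          supNorm (block χ L ((n : ℤ) - 1) (coeff L (u τ))) ^ 2) ≤
        ENNReal.ofReal (CB ^ (3 - s) * lam L 0 ^ s) * B} with hS
  have hne : S.Nonempty := by
    by_contra h
    rw [Set.not_nonempty_iff_eq_empty.1 h, Real.sSup_empty] at hd
    norm_num at hd
  have hbdd : BddAbove S := by
    by_contra h
    rw [Real.sSup_of_not_bddAbove h] at hd
    norm_num at hd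
  obtain ⟨s, -, hs, hsS⟩ := exists_seq_tendsto_sSup hne hbdd
  rw [hd] at hs
  have hmeas : ∀ m : ℕ, Measurable fun τ => supNorm (block χ L m (coeff L (u τ))) ^ 2 :=
    fun m => (measurable_supNorm_block hχ hc m).pow_const 2
  have hl0 := lam_pos hL 0
  have hpart : ∀ (F : Finset ℕ) (r : ℝ), r ∈ S →
      ∑ m ∈ F, ENNReal.ofReal (lam L m ^ (-1 + r)) * A m ≤
        ENNReal.ofReal (CB ^ (3 - r) * lam L 0 ^ r) * B := by
    intro F r hr
    refine le_trans ?_ hr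
    refine (ENNReal.sum_le_tsum F).trans ?_
    rw [← timeAvg_tsum hmeas]
    refine timeAvg_mono fun τ _ => ?_
    have := ENNReal.tsum_comp_le_tsum_of_injective (add_left_injective 1)
      (fun n : ℕ => ENNReal.ofReal (lam L ((n : ℤ) - 1) ^ (-1 + r)) *
          supNorm (block χ L ((n : ℤ) - 1) (coeff L (u τ))) ^ 2)
    simpa using this
  have hfin : ∀ F : Finset ℕ, ∑ m ∈ F, ENNReal.ofReal (lam L m ^ (-1 + 3 : ℝ)) * A m ≤
        ENNReal.ofReal (CB ^ (3 - 3 : ℝ) * lam L 0 ^ (3 : ℝ)) * B := by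
    intro F
    refine le_of_tendsto_of_tendsto' (b := Filter.atTop) ?_ ?_ fun n => hpart F (s n) (hsS n)
    · refine tendsto_finsetSum _ fun m _ => ?_
      have hlm := lam_pos hL m
      refine ENNReal.Tendsto.mul_const ?_ (Or.inl ?_)
      · exact ENNReal.tendsto_ofReal
          ((Real.continuous_const_rpow hlm.ne').tendsto _ |>.comp (hs.const_add _))
      · rw [Ne, ENNReal.ofReal_eq_zero, not_le]; positivity
    · refine ENNReal.Tendsto.mul_const ?_ (Or.inl ?_)
      · refine ENNReal.tendsto_ofReal (Filter.Tendsto.mul ?_ ?_)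
        · exact (Real.continuous_const_rpow hCB.ne').tendsto _ |>.comp (hs.const_sub _)
        · exact (Real.continuous_const_rpow hl0.ne').tendsto _ |>.comp hs
      · rw [Ne, ENNReal.ofReal_eq_zero, not_le]; positivity
  have e1 : (-1 + 3 : ℝ) = (2 : ℕ) := by norm_num
  have e2 : (3 : ℝ) = (3 : ℕ) := by norm_num
  rw [sub_self, Real.rpow_zero, one_mul, e1, e2] at hfin
  simp only [Real.rpow_natCast] at hfin
  simp only [supSq]
  rw [timeAvg_tsum hmeas, ENNReal.tsum_eq_iSup_sum]
  exact iSup_le hfin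

end

/-- Jensen's inequality for the fourth power, in the form in which it is applied to time averages. -/
lemma average_le_of_pow_four_le {g s : ℝ → ℝ} {t T a : ℝ} (hT : 0 < T)
    (hg : IntervalIntegrable g volume t (t + T)) (hs : IntervalIntegrable s volume t (t + T))
    (h : ∀ᵐ τ ∂(volume.restrict (Icc t (t + T))), 0 ≤ g τ ∧ g τ ^ 4 ≤ s τ) (ha : 0 ≤ a)
    (hsa : 1 / T * ∫ τ in t..(t + T), s τ ≤ a ^ 4) : 1 / T * ∫ τ in t..(t + T), g τ ≤ a := by
  refine le_of_forall_pos_le_add fun ε hε => ?_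
  set b := a + ε with hb
  have hb0 : 0 < b := by positivity
  -- The tangent line of `y ↦ y ^ (1 / 4)` at `b ^ 4`.
  have hpt : ∀ᵐ τ ∂(volume.restrict (Icc t (t + T))), g τ ≤ 3 / 4 * b + 1 / (4 * b ^ 3) * s τ := by
    filter_upwards [h] with τ hτ
    have h1 : g τ ≤ 3 / 4 * b + 1 / (4 * b ^ 3) * g τ ^ 4 := by
      have : 3 / 4 * b + 1 / (4 * b ^ 3) * g τ ^ 4 - g τ =
          (g τ - b) ^ 2 * ((g τ + b) ^ 2 + 2 * b ^ 2) / (4 * b ^ 3) := by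
        field_simp; ring
      have h2 : 0 ≤ (g τ - b) ^ 2 * ((g τ + b) ^ 2 + 2 * b ^ 2) / (4 * b ^ 3) := by positivity
      linarith
    have : 1 / (4 * b ^ 3) * g τ ^ 4 ≤ 1 / (4 * b ^ 3) * s τ := by gcongr; exact hτ.2
    linarith
  have hconst : IntervalIntegrable (fun _ : ℝ => 3 / 4 * b) volume t (t + T) :=
    intervalIntegrable_const
  have hmono := intervalIntegral.integral_mono_ae_restrict (by linarith) hg
    (hconst.add (hs.const_mul (1 / (4 * b ^ 3)))) hpt
  rw [intervalIntegral.integral_add hconst (hs.const_mul _), intervalIntegral.integral_const,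
    intervalIntegral.integral_const_mul, add_sub_cancel_left, smul_eq_mul] at hmono
  have hab : a ^ 4 ≤ b ^ 4 := by gcongr; linarith
  calc 1 / T * ∫ τ in t..(t + T), g τ
      ≤ 1 / T * (T * (3 / 4 * b) + 1 / (4 * b ^ 3) * ∫ τ in t..(t + T), s τ) := by gcongr
    _ = 3 / 4 * b + 1 / (4 * b ^ 3) * (1 / T * ∫ τ in t..(t + T), s τ) := by field_simp
    _ ≤ 3 / 4 * b + 1 / (4 * b ^ 3) * b ^ 4 := by gcongr; exact hsa.trans hab
    _ = b := by field_simp; ring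

/-! ### Energy estimates for complete Leray–Hopf solutions -/

section

variable {L : ℝ}

/-- **Poincaré's inequality** for mean-zero fields. -/
lemma poincare (hL : 0 < L) (v : L2 L) (hv : coeff L v 0 = 0) :
    ENNReal.ofReal (kappa0 L ^ 2 * ‖v‖ ^ 2) ≤ gradSq L v := by
  have hk0 : 0 < kappa0 L := by have := Real.pi_pos; unfold kappa0; positivity
  rw [ENNReal.ofReal_mul (by positivity), ← parseval hL, mul_left_comm, gradSq,
    ← ENNReal.tsum_mul_left (a := ENNReal.ofReal (kappa0 L ^ 2))]
  refine mul_le_mul_right (ENNReal.tsum_le_tsum fun k => ?_) _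
  rcases eq_or_ne k 0 with rfl | hk
  · simp [hv]
  gcongr
  exact le_mul_of_one_le_right hk0.le (one_le_norm_freqVec hk)

/-- The duality between `H⁻¹` and `H¹`, combined with Young's inequality. -/
lemma ofReal_pairing_le (hχ : IsCutoff χ) (hL : 0 < L) {ν : ℝ} (hν : 0 < ν) {fhat : Freq → C3}
    (hf : fhat 0 = 0) (v : E3 → E3) :
    ENNReal.ofReal (pairing L fhat (coeff L v)) ≤
      ENNReal.ofReal (ν / 2) * gradSq L v +
        ENNReal.ofReal (1 / (2 * ν)) * sobolevSq χ L (-1) fhat := by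
  have hpi := Real.pi_pos
  have hterm : ∀ k, ‖(inner ℂ (coeff L v k) (fhat k)).re‖ₑ ≤
      ENNReal.ofReal (ν / 2) *
        (ENNReal.ofReal ((2 * Real.pi / L * ‖freqVec k‖) ^ 2) * ‖coeff L v k‖ₑ ^ 2) +
      ENNReal.ofReal (1 / (2 * ν)) * (weight χ L (-1) k * ‖fhat k‖ₑ ^ 2) := by
    intro k
    rcases eq_or_ne k 0 with rfl | hk
    · simp [hf]
    refine le_trans ?_ (add_le_add le_rfl (mul_le_mul_right
      (mul_le_mul_left (ofReal_inv_sq_le_weight hχ hL hk) _) _))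
    have hk1 : 0 < ‖freqVec k‖ := one_pos.trans_le (one_le_norm_freqVec hk)
    set w := 2 * Real.pi / L * ‖freqVec k‖
    have hw : 0 < w := by positivity
    rw [← ofReal_norm (coeff L v k), ← ofReal_norm (fhat k), ← ENNReal.ofReal_pow (norm_nonneg _),
      ← ENNReal.ofReal_pow (norm_nonneg _), ← ENNReal.ofReal_mul (by positivity),
      ← ENNReal.ofReal_mul (by positivity), ← ENNReal.ofReal_mul (by positivity),
      ← ENNReal.ofReal_mul (by positivity), ← ENNReal.ofReal_add (by positivity) (by positivity),
      ← ofReal_norm]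
    refine ENNReal.ofReal_le_ofReal ?_
    refine ((Complex.abs_re_le_norm _).trans (norm_inner_le_norm _ _)).trans ?_
    set a := ‖coeff L v k‖
    set b := ‖fhat k‖
    have : ν / 2 * (w ^ 2 * a ^ 2) + 1 / (2 * ν) * ((w ^ 2)⁻¹ * b ^ 2) - a * b =
        (ν * w ^ 2 * a - b) ^ 2 / (2 * ν * w ^ 2) := by field_simp; ring
    have h2 : 0 ≤ (ν * w ^ 2 * a - b) ^ 2 / (2 * ν * w ^ 2) := by positivity
    linarith
  rw [pairing, ENNReal.ofReal_mul (by positivity), sobolevSq_eq_tsum hχ hL (-1) hf, gradSq,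
    mul_left_comm, mul_left_comm _ (ENNReal.ofReal (L ^ 3)), ← mul_add]
  refine mul_le_mul_right ?_ _
  refine (Real.ofReal_le_enorm _).trans (enorm_tsum_le_tsum_enorm.trans ?_)
  refine (ENNReal.tsum_le_tsum hterm).trans (le_of_eq ?_)
  rw [ENNReal.tsum_add, ENNReal.tsum_mul_left, ENNReal.tsum_mul_left]

end

section

variable {L ν T : ℝ} {f : ℝ → Freq → C3} {u : ℝ → L2 L}

lemma IsCompleteLerayHopf.continuous_inner (hu : IsCompleteLerayHopf L ν f u) (g : L2 L) :
    Continuous fun t => inner ℝ g (u t) := by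
  refine continuous_iff_continuousAt.2 fun t => ?_
  have h := (hu (1 - t)).weakly_continuous g
  have h1 : ContinuousAt (fun r => inner ℝ g (u (r - (1 - t)))) 1 :=
    h.continuousAt (Ici_mem_nhds one_pos)
  have h2 : ContinuousAt (fun r : ℝ => r + (1 - t)) t := by fun_prop
  have h3 := ContinuousAt.comp (f := fun r : ℝ => r + (1 - t)) (x := t)
    (g := fun r => inner ℝ g (u (r - (1 - t)))) (by simpa using h1) h2
  simpa [Function.comp_def] using h3

lemma IsCompleteLerayHopf.coeff_zero (hu : IsCompleteLerayHopf L ν f u) (t : ℝ) :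
    coeff L (u t) 0 = 0 := by
  have h := (hu (-t)).solenoidal 0 le_rfl
  simp only [sub_neg_eq_add, zero_add] at h
  exact coeff_zero_of_isSolenoidal h

lemma IsCompleteLerayHopf.continuous_coeff (hu : IsCompleteLerayHopf L ν f u) (k : Freq) :
    Continuous fun t => coeff L (u t) k :=
  NSE.continuous_coeff hu.continuous_inner k

lemma IsCompleteLerayHopf.lintegral_gradSq_lt_top (hu : IsCompleteLerayHopf L ν f u) (a b : ℝ) :
    ∫⁻ τ in Icc a b, gradSq L (u τ) < ⊤ := by
  have h := (hu (1 - a)).locally_H1 1 (b + (1 - a)) one_pos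
  have hm : Measurable fun τ => gradSq L (u (τ - (1 - a))) :=
    (measurable_gradSq hu.continuous_coeff).comp (measurable_id.sub_const _)
  rw [← (measurePreserving_add_right volume (1 - a)).setLIntegral_comp_preimage measurableSet_Icc hm]
    at h
  simpa using h

/-- The energy inequality of a complete solution, from almost every initial time on the line. -/
lemma IsCompleteLerayHopf.energy (hu : IsCompleteLerayHopf L ν f u) :
    ∀ᵐ t₀ : ℝ, ∀ t, t₀ < t → 1 / 2 * ‖u t‖ ^ 2 ≤ 1 / 2 * ‖u t₀‖ ^ 2
      - ν * (∫ τ in t₀..t, (gradSq L (u τ)).toReal)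
      + ∫ τ in t₀..t, pairing L (f τ) (coeff L (u τ)) := by
  have h : ∀ n : ℕ, ∀ᵐ r : ℝ, 0 < r + n → ∀ t, r < t → 1 / 2 * ‖u t‖ ^ 2 ≤ 1 / 2 * ‖u r‖ ^ 2
      - ν * (∫ τ in r..t, (gradSq L (u τ)).toReal)
      + ∫ τ in r..t, pairing L (f τ) (coeff L (u τ)) := by
    intro n
    have h1 := (ae_restrict_iff' measurableSet_Ioi).1 (hu n).energy
    have h2 := (measurePreserving_add_right volume (n : ℝ)).quasiMeasurePreserving.ae h1
    filter_upwards [h2] with r hr hr0 t ht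
    have h3 := hr hr0 (t + n) (by linarith)
    rw [intervalIntegral.integral_comp_sub_right (fun τ => (gradSq L (u τ)).toReal),
      intervalIntegral.integral_comp_sub_right (fun τ => pairing L (f τ) (coeff L (u τ)))] at h3
    simpa using h3
  filter_upwards [ae_all_iff.2 h] with r hr
  obtain ⟨n, hn⟩ := exists_nat_gt (-r)
  exact hr n (by linarith)

/-- An interval is covered by at most `(b - a) / T + 1` intervals of length `T`. -/
lemma lintegral_force_le (hT : 0 < T) (f : ℝ → Freq → C3) {a b : ℝ} (hab : a ≤ b) :
    ∫⁻ τ in Icc a b, sobolevSq χ L (-1) (f τ) ≤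
      ENNReal.ofReal (b - a + T) * forceBoundSq χ L T f := by
  set g := fun τ => sobolevSq χ L (-1) (f τ)
  set B := forceBoundSq χ L T f
  have h1 : ∀ s, ∫⁻ τ in Icc s (s + T), g τ ≤ ENNReal.ofReal T * B := by
    intro s
    have h : timeAvg T s g ≤ B := le_iSup (fun t => timeAvg T t g) s
    rw [timeAvg] at h
    have hT0 : ENNReal.ofReal T ≠ 0 := by rw [Ne, ENNReal.ofReal_eq_zero, not_le]; exact hT
    calc _ = ENNReal.ofReal T * ((ENNReal.ofReal T)⁻¹ * ∫⁻ τ in Icc s (s + T), g τ) := by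
          rw [← mul_assoc, ENNReal.mul_inv_cancel hT0 ENNReal.ofReal_ne_top, one_mul]
      _ ≤ _ := by gcongr
  have h2 : ∀ n : ℕ, ∫⁻ τ in Icc a (a + (n + 1) * T), g τ ≤ (n + 1) * (ENNReal.ofReal T * B) := by
    intro n
    induction n with
    | zero => simpa using h1 a
    | succ n ih =>
      have hsub : Icc a (a + ((n + 1 : ℕ) + 1) * T) ⊆
          Icc a (a + (n + 1) * T) ∪ Icc (a + (n + 1) * T) (a + (n + 1) * T + T) := by
        intro τ hτ
        rcases le_total τ (a + (n + 1) * T) with h | h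
        · exact Or.inl ⟨hτ.1, h⟩
        · exact Or.inr ⟨h, hτ.2.trans (by push_cast; linarith)⟩
      refine (lintegral_mono_set hsub).trans ((lintegral_union_le _ _ _).trans ?_)
      refine (add_le_add ih (h1 _)).trans (le_of_eq ?_)
      push_cast
      ring
  obtain ⟨n, hn⟩ : ∃ n : ℕ, n = ⌊(b - a) / T⌋₊ := ⟨_, rfl⟩
  have hn1 : b - a < (n + 1) * T := by
    rw [← div_lt_iff₀ hT, hn]; exact Nat.lt_floor_add_one _
  have hn2 : n * T ≤ b - a := by
    rw [← le_div_iff₀ hT, hn]; exact Nat.floor_le (div_nonneg (by linarith) hT.le)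
  refine (lintegral_mono_set (Icc_subset_Icc_right (by linarith :
    b ≤ a + (n + 1) * T))).trans ((h2 n).trans ?_)
  rw [← mul_assoc]
  gcongr
  have : ((n : ℝ≥0∞) + 1) = ENNReal.ofReal (n + 1) := by
    rw [ENNReal.ofReal_add (by positivity) zero_le_one]; simp
  rw [this, ← ENNReal.ofReal_mul (by positivity)]
  exact ENNReal.ofReal_le_ofReal (by linarith)

/-- The energy inequality after absorbing half of the dissipation. -/
lemma IsCompleteLerayHopf.energy_absorbed (hu : IsCompleteLerayHopf L ν f u) (hχ : IsCutoff χ)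
    (hL : 0 < L) (hν : 0 < ν) (hT : 0 < T) (hf : IsForce χ L T f) :
    ∀ᵐ t₀ : ℝ, ∀ t, t₀ < t →
      ‖u t‖ ^ 2 + ν * (∫⁻ τ in Icc t₀ t, gradSq L (u τ)).toReal ≤
        ‖u t₀‖ ^ 2 + (t - t₀ + T) * (forceBoundSq χ L T f).toReal / ν := by
  filter_upwards [hu.energy] with t₀ h t ht
  have h := h t ht
  have hYm := measurable_gradSq hu.continuous_coeff
  have hYfin := hu.lintegral_gradSq_lt_top t₀ t
  have hFfin := hf.bounded
  have hY : ∫ τ in t₀..t, (gradSq L (u τ)).toReal =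
      (∫⁻ τ in Icc t₀ t, gradSq L (u τ)).toReal := by
    rw [intervalIntegral.integral_of_le ht.le, ← integral_Icc_eq_integral_Ioc,
      integral_toReal hYm.aemeasurable (ae_lt_top hYm hYfin.ne)]
  have hF := lintegral_force_le (χ := χ) (L := L) hT f ht.le
  have hP : ∫ τ in t₀..t, pairing L (f τ) (coeff L (u τ)) ≤
      (ENNReal.ofReal (ν / 2) * (∫⁻ τ in Icc t₀ t, gradSq L (u τ)) + ENNReal.ofReal (1 / (2 * ν)) *
        (ENNReal.ofReal (t - t₀ + T) * forceBoundSq χ L T f)).toReal := by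
    rw [intervalIntegral.integral_of_le ht.le, ← integral_Icc_eq_integral_Ioc]
    -- If the pairing is not integrable, its integral is `0` by convention.
    by_cases hint : Integrable (fun τ => pairing L (f τ) (coeff L (u τ)))
        (volume.restrict (Icc t₀ t))
    swap
    · rw [integral_undef hint]; exact ENNReal.toReal_nonneg
    rw [integral_eq_lintegral_pos_part_sub_lintegral_neg_part hint]
    refine (sub_le_self _ ENNReal.toReal_nonneg).trans (ENNReal.toReal_mono ?_ ?_)
    · exact ENNReal.add_ne_top.2 ⟨ENNReal.mul_ne_top ENNReal.ofReal_ne_top hYfin.ne,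
        ENNReal.mul_ne_top ENNReal.ofReal_ne_top
          (ENNReal.mul_ne_top ENNReal.ofReal_ne_top hFfin.ne)⟩
    refine (lintegral_mono fun τ => ofReal_pairing_le hχ hL hν (hf.mean_zero τ) (u τ)).trans ?_
    rw [lintegral_add_left (hYm.const_mul _), lintegral_const_mul _ hYm,
      lintegral_const_mul' _ _ ENNReal.ofReal_ne_top]
    gcongr
  rw [ENNReal.toReal_add (ENNReal.mul_ne_top ENNReal.ofReal_ne_top hYfin.ne)
    (ENNReal.mul_ne_top ENNReal.ofReal_ne_top (ENNReal.mul_ne_top ENNReal.ofReal_ne_top hFfin.ne)),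
    ENNReal.toReal_mul, ENNReal.toReal_mul, ENNReal.toReal_mul,
    ENNReal.toReal_ofReal (by positivity), ENNReal.toReal_ofReal (by positivity),
    ENNReal.toReal_ofReal (by linarith)] at hP
  rw [hY] at h
  set B := (forceBoundSq χ L T f).toReal
  have e : 1 / (2 * ν) * ((t - t₀ + T) * B) = (t - t₀ + T) * B / ν / 2 := by
    field_simp
  linarith

lemma exists_mem_Ioo_of_ae {p : ℝ → Prop} (hp : ∀ᵐ t, p t) {a b : ℝ} (hab : a < b) :
    ∃ t ∈ Ioo a b, p t := by
  have hne : (ae (volume.restrict (Ioo a b))).NeBot := by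
    rw [ae_restrict_neBot, Real.volume_Ioo, Ne, ENNReal.ofReal_eq_zero, not_le]
    linarith
  obtain ⟨t, h1, h2⟩ := ((ae_restrict_mem (measurableSet_Ioo (a := a) (b := b))).and
    (ae_restrict_of_ae hp)).exists
  exact ⟨t, h1, h2⟩

/-- A bounded complete solution lies in an absorbing ball. On a time interval of the length
`2 / (νκ₀²)` on which the linear decay acts, some value of `‖u‖²` is at most half of the supremum
up to the contribution of the force; the energy inequality from there closes the estimate. -/
lemma IsCompleteLerayHopf.norm_sq_le (hu : IsCompleteLerayHopf L ν f u) (hχ : IsCutoff χ)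
    (hL : 0 < L) (hν : 0 < ν) (hT : 0 < T) (hf : IsForce χ L T f) (hb : IsBoundedL2 L u) (t : ℝ) :
    ‖u t‖ ^ 2 ≤ 3 * ((4 / (ν * kappa0 L ^ 2) + T) * (forceBoundSq χ L T f).toReal / ν) := by
  have hk0 : 0 < kappa0 L := by have := Real.pi_pos; unfold kappa0; positivity
  set h := 2 / (ν * kappa0 L ^ 2) with hh
  have hh0 : 0 < h := by positivity
  set B := (forceBoundSq χ L T f).toReal
  have hB0 : 0 ≤ B := ENNReal.toReal_nonneg
  set W := (4 / (ν * kappa0 L ^ 2) + T) * B / ν with hW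
  have hhW : ∀ r, r ≤ 2 * h → (r + T) * B / ν ≤ W := by
    intro r hr
    have : 2 * h = 4 / (ν * kappa0 L ^ 2) := by rw [hh]; ring
    rw [hW, ← this]
    gcongr
  obtain ⟨R, hR⟩ := hb
  have hbdd : BddAbove (range fun t => ‖u t‖ ^ 2) := by
    refine ⟨R ^ 2, ?_⟩
    rintro _ ⟨t, rfl⟩
    exact pow_le_pow_left₀ (norm_nonneg _) (hR t) 2
  set M := ⨆ t, ‖u t‖ ^ 2 with hM
  have hleM : ∀ t, ‖u t‖ ^ 2 ≤ M := fun t => le_ciSup hbdd t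
  have hen := hu.energy_absorbed hχ hL hν hT hf
  have hYm := measurable_gradSq hu.continuous_coeff
  have hhalf : ∀ t, ‖u t‖ ^ 2 ≤ (M + W) / 2 + W := by
    intro t
    obtain ⟨s, hs, hsE⟩ := exists_mem_Ioo_of_ae hen (by linarith : t - 2 * h < t - h)
    have h1 := hsE t (by linarith [hs.2])
    have h2 := hhW (t - s) (by linarith [hs.1])
    have hYfin := hu.lintegral_gradSq_lt_top s t
    set I := ∫⁻ τ in Icc s t, gradSq L (u τ)
    have h3 : ν * I.toReal ≤ M + W := by nlinarith [hleM s, sq_nonneg ‖u t‖]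
    have hvol : volume (Ioo (t - h) t) = ENNReal.ofReal h := by
      rw [Real.volume_Ioo]; congr 1; ring
    have hne : volume.restrict (Ioo (t - h) t) ≠ 0 := by
      rw [Ne, Measure.restrict_eq_zero, hvol, ENNReal.ofReal_eq_zero, not_le]
      exact hh0
    -- A time at which the dissipation is at most its mean, outside the null set `N` of times from
    -- which the energy inequality is not available.
    obtain ⟨N, hN⟩ : ∃ N : Set ℝ, N = {r | ¬ (r ∈ Ioo (t - h) t ∧ ∀ t, r < t →
      ‖u t‖ ^ 2 + ν * (∫⁻ τ in Icc r t, gradSq L (u τ)).toReal ≤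
        ‖u r‖ ^ 2 + (t - r + T) * B / ν)} := ⟨_, rfl⟩
    have hN0 : volume.restrict (Ioo (t - h) t) N = 0 := by
      rw [hN, ← ae_iff]
      exact (ae_restrict_mem measurableSet_Ioo).and (ae_restrict_of_ae hen)
    obtain ⟨r, hr, hrY⟩ := exists_notMem_null_le_laverage hne hYm.aemeasurable hN0
    rw [hN] at hr
    simp only [mem_ofPred_eq, not_not] at hr
    have h4 := hr.2 t hr.1.2
    have h5 := hhW (t - r) (by linarith [hr.1.1])
    have h6 : kappa0 L ^ 2 * ‖u r‖ ^ 2 ≤ I.toReal / h := by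
      have h7 := (poincare hL (u r) (hu.coeff_zero r)).trans hrY
      rw [setLAverage_eq, hvol] at h7
      have h8 : (∫⁻ τ in Ioo (t - h) t, gradSq L (u τ)) / ENNReal.ofReal h ≤
          I / ENNReal.ofReal h := by
        refine ENNReal.div_le_div_right (lintegral_mono_set fun τ hτ => ?_) _
        exact ⟨by linarith [hs.2, hτ.1], hτ.2.le⟩
      have h9 := (h7.trans h8)
      rw [← ENNReal.ofReal_toReal hYfin.ne, ← ENNReal.ofReal_div_of_pos hh0] at h9
      exact (ENNReal.ofReal_le_ofReal_iff (by positivity)).1 h9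
    have h10 : ‖u r‖ ^ 2 ≤ (M + W) / 2 := by
      have e : ν * (kappa0 L ^ 2 * h) = 2 := by rw [hh]; field_simp
      rw [le_div_iff₀ hh0] at h6
      have h11 : ν * (kappa0 L ^ 2 * ‖u r‖ ^ 2 * h) ≤ ν * I.toReal := by gcongr
      have h12 : ν * (kappa0 L ^ 2 * ‖u r‖ ^ 2 * h) = 2 * ‖u r‖ ^ 2 := by
        rw [← e]; ring
      linarith
    have h13 : 0 ≤ ν * (∫⁻ τ in Icc r t, gradSq L (u τ)).toReal :=
      mul_nonneg hν.le ENNReal.toReal_nonneg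
    linarith
  have : M ≤ (M + W) / 2 + W := ciSup_le hhalf
  exact (hleM t).trans (by linarith)

/-- The mean dissipation of a bounded complete solution is controlled by the force. -/
lemma IsCompleteLerayHopf.timeAvg_gradSq_le (hu : IsCompleteLerayHopf L ν f u) (hχ : IsCutoff χ)
    (hL : 0 < L) (hν : 0 < ν) (hT : 0 < T) (hf : IsForce χ L T f) (hb : IsBoundedL2 L u) (t : ℝ) :
    (timeAvg T t fun τ => gradSq L (u τ)).toReal ≤
      12 * (forceBoundSq χ L T f).toReal / ν ^ 2 * (1 / (ν * T * kappa0 L ^ 2) + 1) := by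
  have hk0 : 0 < kappa0 L := by have := Real.pi_pos; unfold kappa0; positivity
  obtain ⟨s, hs, hsE⟩ := exists_mem_Ioo_of_ae (hu.energy_absorbed hχ hL hν hT hf)
    (by linarith : t - T < t)
  have h1 := hsE (t + T) (by linarith [hs.2])
  have h2 := hu.norm_sq_le hχ hL hν hT hf hb s
  set B := (forceBoundSq χ L T f).toReal
  have hB0 : 0 ≤ B := ENNReal.toReal_nonneg
  have h3 : (∫⁻ τ in Icc t (t + T), gradSq L (u τ)).toReal ≤
      (∫⁻ τ in Icc s (t + T), gradSq L (u τ)).toReal :=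
    ENNReal.toReal_mono (hu.lintegral_gradSq_lt_top _ _).ne
      (lintegral_mono_set (Icc_subset_Icc_left hs.2.le))
  set I := (∫⁻ τ in Icc t (t + T), gradSq L (u τ)).toReal
  have h4 : ν * I ≤ 3 * ((4 / (ν * kappa0 L ^ 2) + T) * B / ν) + 3 * T * B / ν := by
    have h5 : (t + T - s + T) * B / ν ≤ 3 * T * B / ν := by gcongr; linarith [hs.1]
    have h6 : ν * I ≤ ν * (∫⁻ τ in Icc s (t + T), gradSq L (u τ)).toReal := by gcongr
    nlinarith [sq_nonneg ‖u (t + T)‖]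
  rw [timeAvg, ENNReal.toReal_mul, ENNReal.toReal_inv, ENNReal.toReal_ofReal hT.le,
    inv_mul_le_iff₀ hT]
  have h7 : I ≤ (3 * ((4 / (ν * kappa0 L ^ 2) + T) * B / ν) + 3 * T * B / ν) / ν := by
    rw [le_div_iff₀ hν]; linarith
  refine h7.trans ?_
  have e : T * (12 * B / ν ^ 2 * (1 / (ν * T * kappa0 L ^ 2) + 1)) -
      (3 * ((4 / (ν * kappa0 L ^ 2) + T) * B / ν) + 3 * T * B / ν) / ν = 6 * T * B / ν ^ 2 := by
    field_simp; ring
  have : 0 ≤ 6 * T * B / ν ^ 2 := by positivity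
  linarith

end

/-! ### Kolmogorov's wavenumber and the Grashof numbers -/

section

variable {CB L ν T t : ℝ} {f : ℝ → Freq → C3} {u : ℝ → L2 L}

lemma kolmogorovWavenumber_nonneg (hL : 0 < L) (hν : 0 < ν) :
    0 ≤ kolmogorovWavenumber χ CB L ν T u t := by
  have := lam_pos hL 0
  unfold kolmogorovWavenumber dissipationRate
  positivity

lemma kolmogorovWavenumber_pow_four (hL : 0 < L) (hν : 0 < ν)
    (hd : intermittencyDim χ CB L T u t = 3) :
    kolmogorovWavenumber χ CB L ν T u t ^ 4 =
      lam L 0 ^ 3 * (timeAvg T t fun τ => gradSq L (u τ)).toReal / ν ^ 2 := by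
  have hl := lam_pos hL 0
  have e3 : (3 : ℝ) = (3 : ℕ) := by norm_num
  have e4 : 1 / ((3 : ℝ) + 1) = 1 / 4 := by norm_num
  have hE : 0 ≤ (timeAvg T t fun τ => gradSq L (u τ)).toReal := ENNReal.toReal_nonneg
  rw [kolmogorovWavenumber, dissipationRate, hd, e4, ← Real.rpow_natCast, ← Real.rpow_mul]
  · rw [e3, Real.rpow_natCast]
    norm_num
    field_simp
  · positivity

/-- Every `G` that dominates the Grashof number of a constant force with the same `H⁻¹` bound
satisfies the estimate of the theorem. -/
lemma kolmogorovWavenumber_le (hu : IsCompleteLerayHopf L ν f u) (hχ : IsCutoff χ)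
    (hL : 0 < L) (hν : 0 < ν) (hT : 0 < T) (hf : IsForce χ L T f) (hb : IsBoundedL2 L u)
    (hd : intermittencyDim χ CB L T u t = 3) {G : ℝ} (hG : 0 ≤ G)
    (hGf : (forceBoundSq χ L T f).toReal / (ν ^ 4 * kappa0 L) ≤ G ^ 2) :
    kolmogorovWavenumber χ CB L ν T u t ≤
      kappa0 L * G ^ (1 / 2 : ℝ) * (1 / (ν * T * kappa0 L ^ 2) + 1) ^ (1 / 4 : ℝ) := by
  have hpi := Real.pi_gt_three
  have hk0 : 0 < kappa0 L := by unfold kappa0; positivity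
  have hl := lam_pos hL 0
  set X := 1 / (ν * T * kappa0 L ^ 2) + 1 with hX
  have hX0 : 0 < X := by positivity
  have hE := hu.timeAvg_gradSq_le hχ hL hν hT hf hb t
  set B := (forceBoundSq χ L T f).toReal
  have hB0 : 0 ≤ B := ENNReal.toReal_nonneg
  have h1 : (G ^ (1 / 2 : ℝ)) ^ 4 = G ^ 2 := by
    rw [← Real.rpow_natCast, ← Real.rpow_mul hG, ← Real.rpow_natCast]; norm_num
  have h2 : (X ^ (1 / 4 : ℝ)) ^ 4 = X := by
    rw [← Real.rpow_natCast, ← Real.rpow_mul hX0.le]; norm_num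
  refine (pow_le_pow_iff_left₀ (kolmogorovWavenumber_nonneg hL hν) (by positivity)
    four_ne_zero).1 ?_
  rw [kolmogorovWavenumber_pow_four hL hν hd, mul_pow, mul_pow, h1, h2]
  have hk : kappa0 L = 2 * Real.pi * lam L 0 := by simp [kappa0, lam]; ring
  have h3 : 12 * lam L 0 ^ 3 ≤ kappa0 L ^ 3 := by
    have : (6 * lam L 0) ^ 3 ≤ kappa0 L ^ 3 := by rw [hk]; gcongr; linarith
    have h0 : 0 < lam L 0 ^ 3 := by positivity
    have e : (6 * lam L 0) ^ 3 = 216 * lam L 0 ^ 3 := by ring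
    linarith
  calc lam L 0 ^ 3 * (timeAvg T t fun τ => gradSq L (u τ)).toReal / ν ^ 2
      ≤ lam L 0 ^ 3 * (12 * B / ν ^ 2 * X) / ν ^ 2 := by gcongr
    _ = (12 * lam L 0 ^ 3) * (B / ν ^ 4 * X) := by field_simp
    _ ≤ kappa0 L ^ 3 * (B / ν ^ 4 * X) := by gcongr
    _ = kappa0 L ^ 4 * (B / (ν ^ 4 * kappa0 L)) * X := by field_simp
    _ ≤ _ := by gcongr

lemma forceBoundSq_le_grashof_sq (hL : 0 < L) (hν : 0 < ν) (hT : 0 < T) :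
    (forceBoundSq χ L T f).toReal / (ν ^ 4 * kappa0 L) ≤ grashof χ L ν T f ^ 2 := by
  have hk0 : 0 < kappa0 L := by have := Real.pi_pos; unfold kappa0; positivity
  set x := ν * kappa0 L ^ 2 * T with hx
  have hx0 : 0 < x := by positivity
  have h1 : 0 < 1 - Real.exp (-x) := by
    have : Real.exp (-x) < 1 := Real.exp_lt_one_iff.2 (by linarith)
    linarith
  have h2 : 1 - Real.exp (-x) ≤ x := by linarith [Real.add_one_le_exp (-x)]
  have hsq : ∀ y : ℝ, 0 ≤ y → (y ^ (1 / 2 : ℝ)) ^ 2 = y := fun y hy => by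
    rw [← Real.sqrt_eq_rpow, Real.sq_sqrt hy]
  have hν3 : (ν ^ (3 / 2 : ℝ)) ^ 2 = ν ^ 3 := by
    rw [← Real.rpow_natCast, ← Real.rpow_mul hν.le, ← Real.rpow_natCast]; norm_num
  have hB0 : 0 ≤ (forceBoundSq χ L T f).toReal := ENNReal.toReal_nonneg
  rw [grashof, div_pow, mul_pow, mul_pow, mul_pow, ← hx, hsq T hT.le, hsq _ hk0.le, hsq _ h1.le, hν3,
    Real.sq_sqrt hB0]
  set B := (forceBoundSq χ L T f).toReal
  calc B / (ν ^ 4 * kappa0 L) = T * kappa0 L * B / (ν ^ 3 * x) := by rw [hx]; field_simp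
    _ ≤ _ := by gcongr

lemma forceBoundSq_eq_of_const (hT : 0 < T) (hconst : ∀ τ, f τ = f 0) :
    forceBoundSq χ L T f = sobolevSq χ L (-1) (f 0) := by
  have hT0 : ENNReal.ofReal T ≠ 0 := by rw [Ne, ENNReal.ofReal_eq_zero, not_le]; exact hT
  have h : ∀ t, timeAvg T t (fun τ => sobolevSq χ L (-1) (f τ)) = sobolevSq χ L (-1) (f 0) := by
    intro t
    simp only [hconst]
    rw [timeAvg, setLIntegral_const, Real.volume_Icc, add_sub_cancel_left, mul_comm, mul_assoc,
      ENNReal.mul_inv_cancel hT0 ENNReal.ofReal_ne_top, mul_one]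
  simp only [forceBoundSq, h, ciSup_const]

lemma forceBoundSq_le_grashofAutonomous_sq (hL : 0 < L) (hT : 0 < T)
    (hconst : ∀ τ, f τ = f 0) :
    (forceBoundSq χ L T f).toReal / (ν ^ 4 * kappa0 L) ≤ grashofAutonomous χ L ν (f 0) ^ 2 := by
  have hk0 : 0 < kappa0 L := by have := Real.pi_pos; unfold kappa0; positivity
  rw [grashofAutonomous, div_pow, mul_pow, ← Real.sqrt_eq_rpow, Real.sq_sqrt hk0.le,
    Real.sq_sqrt ENNReal.toReal_nonneg, forceBoundSq_eq_of_const hT hconst, ← pow_mul]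

end

/-! ### The averaged estimate -/

/-- The constant of the pointwise estimate for the determining wavenumber. -/
def pointwiseConst (c₀ : ℝ) : ℝ := 16 * (32 * Real.pi / 3) ^ 2 / (Real.log 2 * c₀ ^ 2)

lemma pointwiseConst_pos {c₀ : ℝ} (hc₀ : 0 < c₀) : 0 < pointwiseConst c₀ := by
  have := Real.pi_pos
  have := Real.log_pos one_lt_two
  unfold pointwiseConst
  positivity

section

variable {CB L ν T t δ c₀ K : ℝ} {f : ℝ → Freq → C3} {u : ℝ → L2 L}

/-- In dimension `3` the hypothesis on `d` turns the dissipation into a bound for the time average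
of `∑_m λ_m² ‖u_m‖_∞²`. -/
lemma timeAvg_supSq_le_gradSq (hu : IsCompleteLerayHopf L ν f u) (hχ : IsCutoff χ)
    (hCB : 0 < CB) (hL : 0 < L) (hd : intermittencyDim χ CB L T u t = 3)
    (hK : ∀ v : E3 → E3, coeff L v 0 = 0 →
      sobolevSq χ L 1 (coeff L v) ≤ ENNReal.ofReal K * gradSq L v) :
    timeAvg T t (fun τ => supSq χ L (coeff L (u τ))) ≤
      ENNReal.ofReal (lam L 0 ^ 3) * (ENNReal.ofReal K * timeAvg T t fun τ => gradSq L (u τ)) := by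
  refine (timeAvg_supSq_le hχ hCB hL hu.continuous_coeff hd).trans (mul_le_mul_right ?_ _)
  refine (timeAvg_mono fun τ _ => hK (u τ) (hu.coeff_zero τ)).trans (le_of_eq ?_)
  rw [timeAvg, lintegral_const_mul _ (measurable_gradSq hu.continuous_coeff), timeAvg, mul_left_comm]

lemma IsCompleteLerayHopf.timeAvg_gradSq_ne_top (hu : IsCompleteLerayHopf L ν f u) (hT : 0 < T) :
    (timeAvg T t fun τ => gradSq L (u τ)) ≠ ⊤ := by
  have hT0 : ENNReal.ofReal T ≠ 0 := by rw [Ne, ENNReal.ofReal_eq_zero, not_le]; exact hT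
  exact ENNReal.mul_ne_top (ENNReal.inv_ne_top.2 hT0) (hu.lintegral_gradSq_lt_top _ _).ne

/-- The determining wavenumber is defined almost everywhere, the averaged quantity is integrable,
and its average is at most a constant multiple of Kolmogorov's wavenumber. -/
lemma average_excess_le (hu : IsCompleteLerayHopf L ν f u) (hχ : IsCutoff χ)
    (hCB : 0 < CB) (hL : 0 < L) (hν : 0 < ν) (hT : 0 < T) (hδ : δ ≤ 3) (hc₀ : 0 < c₀)
    (hK0 : 0 < K) (hd : intermittencyDim χ CB L T u t = 3)
    (hK : ∀ v : E3 → E3, coeff L v 0 = 0 →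
      sobolevSq χ L 1 (coeff L v) ≤ ENNReal.ofReal K * gradSq L v) :
    (∀ᵐ τ ∂(volume.restrict (Icc t (t + T))), ∃ q, IsAdmissible χ L ν δ c₀ (u τ) q) ∧
      IntervalIntegrable (fun τ => excess χ L ν δ c₀ (u τ)) volume t (t + T) ∧
      1 / T * (∫ τ in t..(t + T), excess χ L ν δ c₀ (u τ)) ≤
        (pointwiseConst c₀ * K) ^ (1 / 4 : ℝ) * kolmogorovWavenumber χ CB L ν T u t := by
  have hc := hu.continuous_coeff
  have hc0 := hu.coeff_zero
  have hC1 := pointwiseConst_pos hc₀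
  have hl := lam_pos hL 0
  have hT0 : ENNReal.ofReal T ≠ 0 := by rw [Ne, ENNReal.ofReal_eq_zero, not_le]; exact hT
  have hSm : Measurable fun τ => supSq χ L (coeff L (u τ)) := measurable_supSq hχ hc
  have hEtop := hu.timeAvg_gradSq_ne_top (t := t) hT
  have hSavg := timeAvg_supSq_le_gradSq hu hχ hCB hL hd hK
  have hStop : timeAvg T t (fun τ => supSq χ L (coeff L (u τ))) ≠ ⊤ :=
    ne_top_of_le_ne_top (ENNReal.mul_ne_top ENNReal.ofReal_ne_top
      (ENNReal.mul_ne_top ENNReal.ofReal_ne_top hEtop)) hSavg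
  have hSint : ∫⁻ τ in Icc t (t + T), supSq χ L (coeff L (u τ)) ≠ ⊤ := by
    intro h
    rw [timeAvg, h] at hStop
    exact hStop (ENNReal.mul_top (ENNReal.inv_ne_zero.2 ENNReal.ofReal_ne_top))
  have hSfin := ae_lt_top hSm hSint
  have hex : ∀ᵐ τ ∂(volume.restrict (Icc t (t + T))), ∃ q, IsAdmissible χ L ν δ c₀ (u τ) q := by
    filter_upwards [hSfin] with τ hτ
    exact exists_isAdmissible hχ hL hν hδ hc₀ (hc0 τ) hτ.ne
  have hpt : ∀ᵐ τ ∂(volume.restrict (Icc t (t + T))), 0 ≤ excess χ L ν δ c₀ (u τ) ∧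
      excess χ L ν δ c₀ (u τ) ^ 4 ≤
        pointwiseConst c₀ / ν ^ 2 * (supSq χ L (coeff L (u τ))).toReal := by
    filter_upwards [hSfin] with τ hτ
    exact excess_nonneg_and_pow_four_le hχ hL hν hδ hc₀ (hc0 τ) hτ.ne
  have hSi : IntegrableOn (fun τ => pointwiseConst c₀ / ν ^ 2 *
      (supSq χ L (coeff L (u τ))).toReal) (Icc t (t + T)) :=
    (integrable_toReal_of_lintegral_ne_top hSm.aemeasurable hSint).const_mul _
  have hgi : IntegrableOn (fun τ => excess χ L ν δ c₀ (u τ)) (Icc t (t + T)) := by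
    refine Integrable.mono' ((integrable_const (1 : ℝ)).add hSi)
      (aemeasurable_excess hχ hL hc hc0 ν δ c₀ hex).aestronglyMeasurable ?_
    filter_upwards [hpt] with τ hτ
    rw [Real.norm_of_nonneg hτ.1, Pi.add_apply]
    set y := excess χ L ν δ c₀ (u τ)
    have : y ≤ 1 + y ^ 4 := by nlinarith [sq_nonneg (y ^ 2 - 1), sq_nonneg (y - 1)]
    linarith [hτ.2]
  have hle : t ≤ t + T := by linarith
  have hgI : IntervalIntegrable (fun τ => excess χ L ν δ c₀ (u τ)) volume t (t + T) :=
    (intervalIntegrable_iff_integrableOn_Icc_of_le hle).2 hgi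
  have hSI := (intervalIntegrable_iff_integrableOn_Icc_of_le hle).2 hSi
  refine ⟨hex, hgI, ?_⟩
  refine average_le_of_pow_four_le hT hgI hSI hpt
    (mul_nonneg (by positivity) (kolmogorovWavenumber_nonneg hL hν)) ?_
  have h4 : ((pointwiseConst c₀ * K) ^ (1 / 4 : ℝ)) ^ 4 = pointwiseConst c₀ * K := by
    rw [← Real.rpow_natCast, ← Real.rpow_mul (by positivity)]; norm_num
  rw [mul_pow, h4, kolmogorovWavenumber_pow_four hL hν hd, intervalIntegral.integral_const_mul,
    intervalIntegral.integral_of_le hle, ← integral_Icc_eq_integral_Ioc,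
    integral_toReal hSm.aemeasurable hSfin]
  have h5 := ENNReal.toReal_mono (ENNReal.mul_ne_top ENNReal.ofReal_ne_top
      (ENNReal.mul_ne_top ENNReal.ofReal_ne_top hEtop)) hSavg
  rw [ENNReal.toReal_mul, ENNReal.toReal_mul, ENNReal.toReal_ofReal (by positivity),
    ENNReal.toReal_ofReal hK0.le, timeAvg, ENNReal.toReal_mul, ENNReal.toReal_inv,
    ENNReal.toReal_ofReal hT.le] at h5
  set E := (timeAvg T t fun τ => gradSq L (u τ)).toReal
  set I := (∫⁻ τ in Icc t (t + T), supSq χ L (coeff L (u τ))).toReal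
  calc 1 / T * (pointwiseConst c₀ / ν ^ 2 * I) = pointwiseConst c₀ / ν ^ 2 * (T⁻¹ * I) := by
        field_simp
    _ ≤ pointwiseConst c₀ / ν ^ 2 * (lam L 0 ^ 3 * (K * E)) := by gcongr
    _ = _ := by field_simp

end

end NSE

end

theorem mainTheorem3 (χ : NSE.E3 → ℝ) (hχ : NSE.IsCutoff χ)
    (δ c₀ : ℝ) (hδ : 0 < δ) (hδ3 : δ ≤ 3) (hc₀ : 0 < c₀) :
    ∃ C : ℝ, 0 < C ∧
      ∀ CB : ℝ, NSE.IsBernsteinConstant χ CB →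
      ∀ (L ν T : ℝ), 0 < L → 0 < ν → 0 < T →
      ∀ f : ℝ → NSE.Freq → NSE.C3, NSE.IsForce χ L T f →
      ∀ u : ℝ → NSE.L2 L, NSE.IsCompleteLerayHopf L ν f u → NSE.IsBoundedL2 L u →
      ∀ t : ℝ, NSE.intermittencyDim χ CB L T u t = 3 →
        (∀ᵐ τ ∂(MeasureTheory.volume.restrict (Set.Icc t (t + T))),
          ∃ q : ℕ, NSE.IsAdmissible χ L ν δ c₀ (u τ) q) ∧
        IntervalIntegrable (fun τ =>
          (NSE.detWavenumber χ L ν δ c₀ (u τ) - NSE.lam L 0) /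
            (Real.log (NSE.detWavenumber χ L ν δ c₀ (u τ) / NSE.lam L 0)) ^ (1 / 4 : ℝ))
          MeasureTheory.volume t (t + T) ∧
        1 / T * (∫ τ in t..(t + T),
          (NSE.detWavenumber χ L ν δ c₀ (u τ) - NSE.lam L 0) /
            (Real.log (NSE.detWavenumber χ L ν δ c₀ (u τ) / NSE.lam L 0)) ^ (1 / 4 : ℝ)) ≤
          C * NSE.kolmogorovWavenumber χ CB L ν T u t ∧
        C * NSE.kolmogorovWavenumber χ CB L ν T u t ≤
          C * (NSE.kappa0 L * NSE.grashof χ L ν T f ^ (1 / 2 : ℝ) *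
            (1 / (ν * T * NSE.kappa0 L ^ 2) + 1) ^ (1 / 4 : ℝ)) ∧
        ((∀ τ, f τ = f 0) →
          C * NSE.kolmogorovWavenumber χ CB L ν T u t ≤
            C * (NSE.kappa0 L * NSE.grashofAutonomous χ L ν (f 0) ^ (1 / 2 : ℝ) *
              (1 / (ν * T * NSE.kappa0 L ^ 2) + 1) ^ (1 / 4 : ℝ))) := by
  obtain ⟨K, hK0, hK⟩ := NSE.exists_sobolevSq_one_le hχ
  have hC1 := NSE.pointwiseConst_pos hc₀
  refine ⟨(NSE.pointwiseConst c₀ * K) ^ (1 / 4 : ℝ), by positivity, ?_⟩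
  intro CB hCB L ν T hL hν hT f hf u hu hb t hd
  obtain ⟨h1, h2, h3⟩ :=
    NSE.average_excess_le hu hχ hCB.1 hL hν hT hδ3 hc₀ hK0 hd (hK L hL)
  have hC0 : 0 ≤ (NSE.pointwiseConst c₀ * K) ^ (1 / 4 : ℝ) := by positivity
  have hG0 : 0 ≤ NSE.grashof χ L ν T f := by
    have hpi := Real.pi_pos
    have hk0 : 0 < NSE.kappa0 L := by unfold NSE.kappa0; positivity
    have hx : 0 < ν * NSE.kappa0 L ^ 2 * T := by positivity
    have : 0 ≤ 1 - Real.exp (-(ν * NSE.kappa0 L ^ 2 * T)) := by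
      have := Real.exp_lt_one_iff.2 (neg_lt_zero.2 hx)
      linarith
    unfold NSE.grashof
    positivity
  have hGa0 : 0 ≤ NSE.grashofAutonomous χ L ν (f 0) := by
    have hpi := Real.pi_pos
    have hk0 : 0 < NSE.kappa0 L := by unfold NSE.kappa0; positivity
    unfold NSE.grashofAutonomous
    positivity
  exact ⟨h1, h2, h3,
    mul_le_mul_of_nonneg_left (NSE.kolmogorovWavenumber_le hu hχ hL hν hT hf hb hd hG0
      (NSE.forceBoundSq_le_grashof_sq hL hν hT)) hC0,
    fun hconst => mul_le_mul_of_nonneg_left (NSE.kolmogorovWavenumber_le hu hχ hL hν hT hf hb hd hGa0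
      (NSE.forceBoundSq_le_grashofAutonomous_sq hL hT hconst)) hC0⟩
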